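/- Let $\Lambda_4$ be the set of partitions $\lambda=(\lambda_1\ge\lambda_2\ge\lambda_3\ge\lambda_4\ge 0)$ with at most $4$ parts and, for $\lambda\in\Lambda_4$, let $V(\lambda)$ be the irreducible polynomial representation of $\mathrm{GL}_4(\mathbb C)$ with highest weight $\lambda$. For $\lambda,\mu,\nu\in\Lambda_4$ let $c_{\lambda\mu}^{\nu}$ be the Littlewood–Richardson coefficient, i.e. the multiplicity of $V(\nu)$ in $V(\lambda)\otimes V(\mu)$. Let $S\subset(\Lambda_4)^3$ be the set of triples $(\lambda,\mu,\nu)$ with $c_{\lambda\mu}^{\nu}\neq 0$ such that $\lambda$ and $\mu$ are near-rectangular ($\lambda_2=\lambda_3$ and $\mu_2=\mu_3$) and $\lambda_4=\mu_4=0$. Then the convex cone generated by $S$ in $\mathbb Q^{12}$ has exactly $8$ extremal rays. They are generated by the $8$ triples $(\lambda,\mu,\nu)$ associated to the following inclusions $V(\nu)\subset V(\lambda)\otimes V(\mu)$: 1. $V(1)\subset V(1)\otimes V(0)$ and $V(1)\subset V(0)\otimes V(1)$; 2. $V(1^3)\subset V(1^3)\otimes V(0)$ and $V(1^3)\subset V(0)\otimes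 V(1^3)$; 3. $V(1^2)\subset V(1)\otimes V(1)$; 4. $V(1^4)\subset V(1)\otimes V(1^3)$ and $V(1^4)\subset V(1^3)\otimes V(1)$; 5. $V(2^21^2)\subset V(1^3)\otimes V(1^3)$. Moreover, every triple $(\lambda,\mu,\nu)$ of partitions lying on one of these extremal rays satisfies $c_{\lambda\mu}^{\nu}=1$, and these $8$ triples form the Hilbert basis of $S$: they generate $S$ as an additive monoid and are contained in every generating set of $S$. -/

import Mathlib

namespace LRCone

open MvPolynomial

/-! ### Polynomial representations of `GL_n(ℂ)` and Littlewood-Richardson coefficients -/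

/-- The substitution `f(X) ↦ f(X A)` on polynomial functions on `n × n` matrices. -/
noncomputable def translate {n : ℕ} (A : Matrix (Fin n) (Fin n) ℂ) :
    MvPolynomial (Fin n × Fin n) ℂ →ₐ[ℂ] MvPolynomial (Fin n × Fin n) ℂ :=
  aeval fun p : Fin n × Fin n => ∑ k, X (p.1, k) * C (A k p.2)

theorem translate_one (n : ℕ) :
    translate (1 : Matrix (Fin n) (Fin n) ℂ) = AlgHom.id ℂ _ := by
  apply MvPolynomial.algHom_ext
  rintro ⟨i, j⟩
  rw [translate, aeval_X, AlgHom.id_apply, Finset.sum_eq_single j]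
  · simp
  · intro k _ hk
    simp [hk]
  · simp

theorem translate_mul {n : ℕ} (A B : Matrix (Fin n) (Fin n) ℂ) :
    translate (A * B) = (translate A).comp (translate B) := by
  apply MvPolynomial.algHom_ext
  rintro ⟨i, j⟩
  rw [AlgHom.comp_apply]
  simp only [translate, aeval_X, map_sum, map_mul, algHom_C, algebraMap_eq, Matrix.mul_apply,
    Finset.mul_sum, Finset.sum_mul]
  rw [Finset.sum_comm]
  simp only [mul_assoc]

/-- The action of `GL_n(ℂ)` on polynomial functions on `n × n` matrices by right translation:
`(g • f)(X) = f (X g)`. -/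
noncomputable def translationRep (n : ℕ) :
    Representation ℂ (GL (Fin n) ℂ) (MvPolynomial (Fin n × Fin n) ℂ) where
  toFun g := (translate (g : Matrix (Fin n) (Fin n) ℂ)).toLinearMap
  map_one' := by
    rw [Units.val_one, translate_one]
    rfl
  map_mul' g h := by
    rw [Units.val_mul, translate_mul]
    rfl

/-- The leading principal minor of size `i + 1` of the generic `n × n` matrix. -/
noncomputable def leadingMinor {n : ℕ} (i : Fin n) : MvPolynomial (Fin n × Fin n) ℂ :=
  Matrix.det (Matrix.of fun a b : Fin (i.val + 1) =>
    (X (Fin.castLE i.isLt a, Fin.castLE i.isLt b) : MvPolynomial (Fin n × Fin n) ℂ))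

/-- `Δ^lam = ∏ᵢ Δᵢ ^ (lamᵢ - lamᵢ₊₁)` (with `lamₙ₊₁ = 0`). For a partition `lam`, it is fixed by the
upper triangular unipotent matrices and is a weight vector of weight `lam` for the diagonal
matrices. -/
noncomputable def highestWeightVector {n : ℕ} (lam : Fin n → ℕ) :
    MvPolynomial (Fin n × Fin n) ℂ :=
  ∏ i : Fin n, leadingMinor i ^
    (lam i - if h : i.val + 1 < n then lam ⟨i.val + 1, h⟩ else 0)

/-- The irreducible polynomial representation `V_n(lam)` of `GL_n(ℂ)` of highest weight the
partition `lam`, realized as the `GL_n(ℂ)`-submodule generated by the highest weight vector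
`Δ^lam` in the polynomial functions on `n × n` matrices. -/
noncomputable def V {n : ℕ} (lam : Fin n → ℕ) : Subrepresentation (translationRep n) where
  toSubmodule := Submodule.span ℂ
    (Set.range fun g : GL (Fin n) ℂ => translationRep n g (highestWeightVector lam))
  apply_mem_toSubmodule g v hv := by
    induction hv using Submodule.span_induction with
    | mem x hx =>
      obtain ⟨h, rfl⟩ := hx
      refine Submodule.subset_span ⟨g * h, ?_⟩
      simp only [map_mul, Module.End.mul_apply]
    | zero => simp
    | add x y _ _ hx hy => rw [map_add]; exact Submodule.add_mem _ hx hy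
    | smul a x _ hx => rw [map_smul]; exact Submodule.smul_mem _ a hx

/-- The Littlewood-Richardson coefficient `c_{lam mu}^nu`: the multiplicity of `V_n(nu)` in
`V_n(lam) ⊗ V_n(mu)`, that is, the dimension of the space of `GL_n(ℂ)`-equivariant linear maps
`V_n(nu) → V_n(lam) ⊗ V_n(mu)`. -/
noncomputable def lrCoeff {n : ℕ} (lam mu nu : Fin n → ℕ) : ℕ :=
  Module.finrank ℂ (Representation.IntertwiningMap (V nu).toRepresentation
    ((V lam).toRepresentation.tprod (V mu).toRepresentation))

/-! ### The Horn semigroups -/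

/-- Triples `(lam, mu, nu)` of `n`-tuples with entries in `ℕ`. -/
abbrev Triple (n : ℕ) : Type := (Fin n → ℕ) × (Fin n → ℕ) × (Fin n → ℕ)

/-- The set `Λ_n` of partitions with at most `n` parts. -/
def partitions (n : ℕ) : Set (Fin n → ℕ) := {lam | Antitone lam}

/-- The set `Λ_n⁰` of partitions in `Λ_n` whose `n`-th part is zero. -/
def partitionsZero (n : ℕ) : Set (Fin n → ℕ) :=
  {lam | lam ∈ partitions n ∧ ∀ i : Fin n, i.val + 1 = n → lam i = 0}

/-- Near-rectangular partitions: `lam₂ = ⋯ = lamₙ₋₁` (indices starting at `1`). -/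
def nearRectangular (n : ℕ) : Set (Fin n → ℕ) :=
  {lam | lam ∈ partitions n ∧ ∀ i j : Fin n, 0 < i.val → i.val + 1 < n →
    0 < j.val → j.val + 1 < n → lam i = lam j}

/-- `Horn_n`: the triples of partitions with nonzero Littlewood-Richardson coefficient. -/
def Horn (n : ℕ) : Set (Triple n) :=
  {t | t.1 ∈ partitions n ∧ t.2.1 ∈ partitions n ∧ t.2.2 ∈ partitions n ∧
    lrCoeff t.1 t.2.1 t.2.2 ≠ 0}

/-- The triples in `Horn_n` whose first two partitions are near-rectangular. -/
def HornNR2 (n : ℕ) : Set (Triple n) :=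
  {t | t ∈ Horn n ∧ t.1 ∈ nearRectangular n ∧ t.2.1 ∈ nearRectangular n}

/-- The triples in `Horn_n` whose first two partitions have zero `n`-th part. -/
def HornBar (n : ℕ) : Set (Triple n) :=
  {t | t ∈ Horn n ∧ t.1 ∈ partitionsZero n ∧ t.2.1 ∈ partitionsZero n}

/-! ### Cones, extremal rays, Hilbert bases -/

/-- The rational vector space containing the triples. -/
abbrev RatTriple (n : ℕ) : Type := (Fin n → ℚ) × (Fin n → ℚ) × (Fin n → ℚ)

/-- The inclusion of integral triples into rational triples. -/
def toRat {n : ℕ} (t : Triple n) : RatTriple n :=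
  (fun i => (t.1 i : ℚ), fun i => (t.2.1 i : ℚ), fun i => (t.2.2 i : ℚ))

/-- The convex cone generated by a set of triples. -/
def coneOf {n : ℕ} (S : Set (Triple n)) : PointedCone ℚ (RatTriple n) :=
  PointedCone.hull ℚ (toRat '' S)

/-- The ray `ℚ≥0 · t` generated by a triple `t`. -/
def ray {n : ℕ} (t : Triple n) : PointedCone ℚ (RatTriple n) :=
  PointedCone.hull ℚ {toRat t}

/-- `R` is an extremal ray of the cone `K`: a face of `K` of the form `ℚ≥0 · v` with `v ≠ 0`. -/
def IsExtremalRay {M : Type*} [AddCommGroup M] [Module ℚ M] (K R : PointedCone ℚ M) : Prop :=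
  R.IsFaceOf K ∧ ∃ v : M, v ≠ 0 ∧ R = PointedCone.hull ℚ {v}

/-- `H` is the Hilbert basis of `S`: it generates `S` as an additive monoid (in particular `S` is
one), and it is contained in every generating set of `S`. -/
def IsHilbertBasis {A : Type*} [AddMonoid A] (S H : Set A) : Prop :=
  IsLeast {H' : Set A | (AddSubmonoid.closure H' : Set A) = S} H

/-- The eight triples `(lam, mu, nu)`, one for each of the inclusions
`V(1) ⊂ V(1) ⊗ V(0)`, `V(1) ⊂ V(0) ⊗ V(1)`, `V(1³) ⊂ V(1³) ⊗ V(0)`, `V(1³) ⊂ V(0) ⊗ V(1³)`,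
`V(1²) ⊂ V(1) ⊗ V(1)`, `V(1⁴) ⊂ V(1) ⊗ V(1³)`, `V(1⁴) ⊂ V(1³) ⊗ V(1)`,
`V(2²1²) ⊂ V(1³) ⊗ V(1³)`. -/
def generators : Set (Triple 4) :=
  {(![1, 0, 0, 0], ![0, 0, 0, 0], ![1, 0, 0, 0]),
   (![0, 0, 0, 0], ![1, 0, 0, 0], ![1, 0, 0, 0]),
   (![1, 1, 1, 0], ![0, 0, 0, 0], ![1, 1, 1, 0]),
   (![0, 0, 0, 0], ![1, 1, 1, 0], ![1, 1, 1, 0]),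
   (![1, 0, 0, 0], ![1, 0, 0, 0], ![1, 1, 0, 0]),
   (![1, 0, 0, 0], ![1, 1, 1, 0], ![1, 1, 1, 1]),
   (![1, 1, 1, 0], ![1, 0, 0, 0], ![1, 1, 1, 1]),
   (![1, 1, 1, 0], ![1, 1, 1, 0], ![2, 2, 1, 1])}

end LRCone

/-! The coefficient $c_{\lambda\mu}^{\nu}$ is the dimension of the space of highest weight vectors
of weight $\nu$ in $V(\lambda)\otimes V(\mu)$ (`lrCoeff_eq_finrank`). This uses that every highest
weight vector is the image of the generator of `V nu`. The Fischer inner product gives this: the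
Gram matrix of the translates of a highest weight vector depends, up to a scalar, only on the
weight. The same inner product identifies $V(a+b,b,b,0)$ with the polynomials of degree $a$ in a row
$x$ and degree $b$ in a covector $h$ of $3\times3$ minors, where $\langle x,h\rangle=0$
(`V_nearRect`). A highest weight vector is thus a multihomogeneous function $f$ of two flags
$(x,h)$, $(y,k)$, semi-invariant under upper triangular matrices.

Eight such functions $p_0,\dots,p_7$ are visible: $x_0$, $y_0$, $h_3$, $k_3$, $x_0y_1-x_1y_0$,
$\langle x,k\rangle$, $\langle y,h\rangle$, $h_2k_3-h_3k_2$. Their weights are the eight triples,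
and their monomials are nonzero, so $S$ contains the monoid generated by these triples.

Conversely, where no $p_i$ vanishes, triangular matrices and rescaling move the pair of flags onto a
one-parameter slice with coordinate $z=p_0p_3p_6/(p_1p_2p_5)$ (`exists_upper_normalization`). Hence
$f=\prod p_i^{o_i}\,\varphi(z)$, with exponents $o_i$ (`order`) linear in the weights. On a curve
along which a single $p_i$ vanishes, to first order, $f$ is polynomial. This bounds the pole of
$\varphi$ at $0$ by $o_i$ for $i=0,3,6$, bounds the pole at infinity by $o_i$ for $i=1,2,5$, and
gives $o_i\ge0$ for $i=4,7$. So $o_i+o_j\ge0$ for $i\in\{0,3,6\}$ and $j\in\{1,2,5\}$. With the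
equality of sizes, these inequalities make the weight that of a monomial in the $p_i$
(`IsHighestWeight.exists_exponents`). If some $o_i+o_j=0$, then $\varphi$ is a monomial and the
multiplicity is one.

The rest is convex geometry. The only linear relation among the generators is
$g_0+g_3+g_6=g_1+g_2+g_5$, up to multiples. As each side has three terms, a nonnegative combination
proportional to $g_i$ involves $g_i$ alone. This gives the extremal rays and the Hilbert basis. On
the ray of $g_i$, an index of each sign other than $i$ has exponent zero, which gives multiplicity
one. -/

namespace LRCone

open MvPolynomial

/-! ### The Fischer inner product on polynomials -/

section Fischer

variable {σ : Type*}

/-- The factorial of a multi-index. -/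
noncomputable def multiFactorial (m : σ →₀ ℕ) : ℕ := m.prod fun _ k => k.factorial

theorem multiFactorial_pos (m : σ →₀ ℕ) : 0 < multiFactorial m :=
  Finset.prod_pos fun _ _ => Nat.factorial_pos _

theorem multiFactorial_add_single (m : σ →₀ ℕ) (i : σ) :
    multiFactorial (m + Finsupp.single i 1) = (m i + 1) * multiFactorial m := by
  classical
  have h1 : ∀ m : σ →₀ ℕ, multiFactorial m =
      (m i).factorial * ∏ j ∈ m.support.erase i, (m j).factorial := by
    intro m
    by_cases h : i ∈ m.support
    · rw [multiFactorial, Finsupp.prod, Finset.mul_prod_erase _ (fun j => (m j).factorial) h]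
    · rw [Finset.erase_eq_of_notMem h, Finsupp.notMem_support_iff.1 h, multiFactorial, Finsupp.prod]
      simp
  rw [h1 (m + _), h1 m, Finsupp.add_apply, Finsupp.single_eq_same, Nat.factorial_succ, mul_assoc]
  congr 2
  have h2 : (m + Finsupp.single i 1).support.erase i = m.support.erase i := by
    ext j
    by_cases hj : j = i
    · simp [hj]
    · simp [hj]
  rw [h2]
  refine Finset.prod_congr rfl fun j hj => ?_
  rw [Finsupp.add_apply, Finsupp.single_eq_of_ne (Finset.ne_of_mem_erase hj), add_zero]

/-- The Fischer inner product `⟨f, g⟩ = ∑ₘ m! conj(fₘ) gₘ`. -/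
noncomputable def fischer (f g : MvPolynomial σ ℂ) : ℂ :=
  ∑ m ∈ f.support, (multiFactorial m : ℂ) * (starRingEnd ℂ (coeff m f) * coeff m g)

theorem fischer_eq_sum {f : MvPolynomial σ ℂ} (g : MvPolynomial σ ℂ) {s : Finset (σ →₀ ℕ)}
    (hs : f.support ⊆ s) :
    fischer f g = ∑ m ∈ s, (multiFactorial m : ℂ) * (starRingEnd ℂ (coeff m f) * coeff m g) := by
  refine Finset.sum_subset hs fun m _ hm => ?_
  rw [notMem_support_iff.1 hm]
  simp

theorem fischer_add_left (f₁ f₂ g : MvPolynomial σ ℂ) :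
    fischer (f₁ + f₂) g = fischer f₁ g + fischer f₂ g := by
  classical
  rw [fischer_eq_sum g (support_add (p := f₁) (q := f₂)),
    fischer_eq_sum g (Finset.subset_union_left (s₁ := f₁.support) (s₂ := f₂.support)),
    fischer_eq_sum g (Finset.subset_union_right (s₁ := f₁.support) (s₂ := f₂.support)),
    ← Finset.sum_add_distrib]
  refine Finset.sum_congr rfl fun m _ => ?_
  rw [coeff_add, map_add]
  ring

theorem fischer_add_right (f g₁ g₂ : MvPolynomial σ ℂ) :
    fischer f (g₁ + g₂) = fischer f g₁ + fischer f g₂ := by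
  simp only [fischer, coeff_add, mul_add, Finset.sum_add_distrib]

theorem fischer_smul_right (f : MvPolynomial σ ℂ) (r : ℂ) (g : MvPolynomial σ ℂ) :
    fischer f (r • g) = r * fischer f g := by
  simp only [fischer, coeff_smul, smul_eq_mul, Finset.mul_sum]
  exact Finset.sum_congr rfl fun m _ => by ring

theorem fischer_conj_symm (f g : MvPolynomial σ ℂ) :
    starRingEnd ℂ (fischer g f) = fischer f g := by
  classical
  rw [fischer_eq_sum f (Finset.subset_union_right (s₁ := f.support) (s₂ := g.support)),
    fischer_eq_sum g (Finset.subset_union_left (s₁ := f.support) (s₂ := g.support)), map_sum]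
  refine Finset.sum_congr rfl fun m _ => ?_
  simp only [map_mul, Complex.conj_conj, map_natCast]
  ring

theorem fischer_smul_left (r : ℂ) (f g : MvPolynomial σ ℂ) :
    fischer (r • f) g = starRingEnd ℂ r * fischer f g := by
  rw [← fischer_conj_symm, fischer_smul_right, map_mul, fischer_conj_symm]

theorem fischer_self (f : MvPolynomial σ ℂ) : fischer f f =
    ((∑ m ∈ f.support, multiFactorial m * Complex.normSq (coeff m f) : ℝ) : ℂ) := by
  rw [fischer, Complex.ofReal_sum]
  refine Finset.sum_congr rfl fun m _ => ?_
  rw [mul_comm (starRingEnd ℂ _), Complex.mul_conj]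
  push_cast
  rfl

theorem fischer_self_re_nonneg (f : MvPolynomial σ ℂ) : 0 ≤ (fischer f f).re := by
  rw [fischer_self, Complex.ofReal_re]
  exact Finset.sum_nonneg fun m _ => mul_nonneg (Nat.cast_nonneg _) (Complex.normSq_nonneg _)

theorem fischer_self_eq_zero {f : MvPolynomial σ ℂ} (h : fischer f f = 0) : f = 0 := by
  rw [fischer_self, Complex.ofReal_eq_zero,
    Finset.sum_eq_zero_iff_of_nonneg fun m _ =>
      mul_nonneg (Nat.cast_nonneg _) (Complex.normSq_nonneg _)] at h
  by_contra hf
  obtain ⟨m, hm⟩ := Finset.nonempty_iff_ne_empty.2 (mt support_eq_empty.1 hf)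
  have := h m hm
  simp [(multiFactorial_pos m).ne', mem_support_iff.1 hm] at this

theorem fischer_C_left (c : ℂ) (g : MvPolynomial σ ℂ) :
    fischer (C c) g = starRingEnd ℂ c * constantCoeff g := by
  classical
  have : (C c : MvPolynomial σ ℂ).support ⊆ {0} := by
    intro m hm
    rw [mem_support_iff, coeff_C] at hm
    simp only [Finset.mem_singleton]
    by_contra h
    exact hm (if_neg (Ne.symm h))
  rw [fischer_eq_sum g this, Finset.sum_singleton]
  simp [multiFactorial, constantCoeff_eq]

/-- The weights $m!$ are chosen for this adjunction: the factor $m_i+1$ gained by the factorial is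
the one produced by differentiation. -/
theorem fischer_mul_X_left (f : MvPolynomial σ ℂ) (i : σ) (g : MvPolynomial σ ℂ) :
    fischer (f * X i) g = fischer f (pderiv i g) := by
  rw [fischer, support_mul_X, Finset.sum_map, fischer]
  refine Finset.sum_congr rfl fun m _ => ?_
  rw [addRightEmbedding_apply, coeff_mul_X, coeff_pderiv, multiFactorial_add_single]
  push_cast
  ring

theorem fischer_zero_right (f : MvPolynomial σ ℂ) : fischer f 0 = 0 := by
  simp [fischer]

theorem fischer_sum_right {ι : Type*} (f : MvPolynomial σ ℂ) (s : Finset ι)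
    (g : ι → MvPolynomial σ ℂ) : fischer f (∑ i ∈ s, g i) = ∑ i ∈ s, fischer f (g i) := by
  classical
  induction s using Finset.induction_on with
  | empty => simp [fischer_zero_right]
  | insert i s hi ih => rw [Finset.sum_insert hi, Finset.sum_insert hi, fischer_add_right, ih]

theorem fischer_sum_left {ι : Type*} (s : Finset ι) (f : ι → MvPolynomial σ ℂ)
    (g : MvPolynomial σ ℂ) : fischer (∑ i ∈ s, f i) g = ∑ i ∈ s, fischer (f i) g := by
  rw [← fischer_conj_symm, fischer_sum_right, map_sum]
  simp only [fischer_conj_symm]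

/-- The Fischer inner product as an inner product space structure. -/
noncomputable abbrev fischerCore (σ : Type*) : InnerProductSpace.Core ℂ (MvPolynomial σ ℂ) where
  inner := fischer
  conj_inner_symm := fischer_conj_symm
  re_inner_nonneg := fischer_self_re_nonneg
  add_left := fischer_add_left
  smul_left f g r := fischer_smul_left r f g
  definite _ := fischer_self_eq_zero

/-- A subspace of a finite-dimensional space of polynomials is the whole space if only zero is
orthogonal to it. -/
theorem le_of_fischer_orthogonal {W B : Submodule ℂ (MvPolynomial σ ℂ)} [FiniteDimensional ℂ W]
    (hWB : W ≤ B) (h : ∀ f ∈ B, (∀ w ∈ W, fischer w f = 0) → f = 0) : B ≤ W := by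
  let := fischerCore σ
  let : NormedAddCommGroup (MvPolynomial σ ℂ) := InnerProductSpace.Core.toNormedAddCommGroup (𝕜 := ℂ)
  let : InnerProductSpace ℂ (MvPolynomial σ ℂ) := InnerProductSpace.ofCore _
  intro f hf
  obtain ⟨y, hy, z, hz, rfl⟩ := W.exists_add_mem_mem_orthogonal f
  have hz0 : z = 0 := by
    refine h z ?_ fun w hw => hz w hw
    have := B.sub_mem hf (hWB hy)
    rwa [add_sub_cancel_left] at this
  rw [hz0, add_zero]
  exact hy

end Fischer

/-! ### Linear substitutions -/

section Act

variable {ι : Type*} {n : ℕ}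

/-- The substitution `f(X) ↦ f(X A)` on polynomial functions on `ι × n` matrices. -/
noncomputable def act (A : Matrix (Fin n) (Fin n) ℂ) :
    MvPolynomial (ι × Fin n) ℂ →ₐ[ℂ] MvPolynomial (ι × Fin n) ℂ :=
  aeval fun p : ι × Fin n => ∑ k, X (p.1, k) * C (A k p.2)

theorem act_X (A : Matrix (Fin n) (Fin n) ℂ) (p : ι × Fin n) :
    act A (X p) = ∑ k, X (p.1, k) * C (A k p.2) := aeval_X _ _

/-- The value of a polynomial function at a matrix. -/
noncomputable def evalAt (M : Matrix ι (Fin n) ℂ) : MvPolynomial (ι × Fin n) ℂ →ₐ[ℂ] ℂ :=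
  aeval fun p => M p.1 p.2

@[simp]
theorem evalAt_X (M : Matrix ι (Fin n) ℂ) (p : ι × Fin n) : evalAt M (X p) = M p.1 p.2 :=
  aeval_X _ _

theorem evalAt_act (M : Matrix ι (Fin n) ℂ) (A : Matrix (Fin n) (Fin n) ℂ)
    (f : MvPolynomial (ι × Fin n) ℂ) : evalAt M (act A f) = evalAt (M * A) f := by
  rw [← AlgHom.comp_apply]
  congr 1
  apply MvPolynomial.algHom_ext
  intro p
  simp [act_X, Matrix.mul_apply, evalAt]

theorem eq_of_evalAt [Finite ι] {f g : MvPolynomial (ι × Fin n) ℂ}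
    (h : ∀ M, evalAt M f = evalAt M g) : f = g := by
  refine MvPolynomial.funext fun x => ?_
  have := h (Matrix.of fun i j => x (i, j))
  simpa [evalAt, aeval_eq_eval] using this

theorem act_mul_apply [Finite ι] (A B : Matrix (Fin n) (Fin n) ℂ)
    (f : MvPolynomial (ι × Fin n) ℂ) : act (A * B) f = act A (act B f) :=
  eq_of_evalAt fun M => by rw [evalAt_act, evalAt_act, evalAt_act, Matrix.mul_assoc]

theorem constantCoeff_act (A : Matrix (Fin n) (Fin n) ℂ) (f : MvPolynomial (ι × Fin n) ℂ) :
    constantCoeff (act A f) = constantCoeff f := by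
  induction f using MvPolynomial.induction_on with
  | C a => simp [algHom_C]
  | add p q hp hq => simp [hp, hq]
  | mul_X p i _ => simp [act_X]

/-- The chain rule for a linear substitution. -/
theorem pderiv_act [DecidableEq ι] (A : Matrix (Fin n) (Fin n) ℂ)
    (f : MvPolynomial (ι × Fin n) ℂ) (i : ι) (j : Fin n) :
    pderiv (i, j) (act A f) = ∑ k, A j k • act A (pderiv (i, k) f) := by
  induction f using MvPolynomial.induction_on with
  | C a => simp [algHom_C]
  | add p q hp hq => simp [hp, hq, Finset.sum_add_distrib]
  | mul_X p q hp =>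
    have h1 : pderiv (i, j) (act A (X q)) = ∑ k, A j k • act A (pderiv (i, k) (X q)) := by
      obtain ⟨i', j'⟩ := q
      by_cases h : i = i'
      · subst h
        simp [act_X, pderiv_X, Pi.single_apply, apply_ite (act A), smul_eq_C_mul]
      · simp [act_X, pderiv_X, Ne.symm h]
    rw [map_mul, Derivation.leibniz, hp, h1]
    simp only [Derivation.leibniz, map_add, smul_eq_mul, map_mul, smul_add, Finset.sum_add_distrib,
      Finset.mul_sum, mul_smul_comm]

/-- Multiplication by a variable is adjoint to the corresponding derivative, so induction on $f$
together with the chain rule moves the substitution across. In particular the Fischer product is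
invariant under unitary matrices. -/
theorem fischer_act (A : Matrix (Fin n) (Fin n) ℂ) (f g : MvPolynomial (ι × Fin n) ℂ) :
    fischer (act A f) g = fischer f (act A.conjTranspose g) := by
  classical
  induction f using MvPolynomial.induction_on generalizing g with
  | C a => rw [algHom_C, algebraMap_eq, fischer_C_left, fischer_C_left, constantCoeff_act]
  | add p q hp hq => rw [map_add, fischer_add_left, fischer_add_left, hp, hq]
  | mul_X p q hp =>
    obtain ⟨i, j⟩ := q
    rw [fischer_mul_X_left, pderiv_act, map_mul, act_X, Finset.mul_sum, fischer_sum_left,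
      fischer_sum_right]
    refine Finset.sum_congr rfl fun k _ => ?_
    rw [fischer_smul_right, ← hp, ← fischer_mul_X_left, Matrix.conjTranspose_apply,
      ← starRingEnd_apply, ← fischer_smul_left]
    congr 1
    rw [smul_eq_C_mul]
    ring

/-- Along a polynomial curve of matrices, polynomial functions are polynomial. -/
theorem exists_polynomial_evalAt (M : Matrix ι (Fin n) (Polynomial ℂ))
    (f : MvPolynomial (ι × Fin n) ℂ) :
    ∃ P : Polynomial ℂ, ∀ s, P.eval s = evalAt (M.map (Polynomial.eval s)) f := by
  refine ⟨aeval (fun p : ι × Fin n => M p.1 p.2) f, fun s => ?_⟩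
  induction f using MvPolynomial.induction_on with
  | C a => simp [algHom_C]
  | add p q hp hq => simp [hp, hq]
  | mul_X p q hp => simp [hp]

end Act
end LRCone

namespace LRCone

open MvPolynomial

/-! ### Triangular matrices and highest weight vectors -/

section Triangular

variable {ι : Type*} {n : ℕ}

theorem evalAt_leadingMinor (M : Matrix (Fin n) (Fin n) ℂ) (i : Fin n) :
    evalAt M (leadingMinor i) =
      (M.submatrix (Fin.castLE (Nat.succ_le_of_lt i.isLt))
        (Fin.castLE (Nat.succ_le_of_lt i.isLt))).det := by
  rw [leadingMinor, AlgHom.map_det]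
  congr 1
  ext a b
  simp

/-- For upper triangular $b$, the first columns of $Mb$ involve only the same first columns of $M$,
so the leading block of the product is the product of the leading blocks. -/
theorem evalAt_leadingMinor_mul (M : Matrix (Fin n) (Fin n) ℂ) {b : Matrix (Fin n) (Fin n) ℂ}
    (hb : b.BlockTriangular id) (i : Fin n) :
    evalAt (M * b) (leadingMinor i) = evalAt M (leadingMinor i) * evalAt b (leadingMinor i) := by
  simp only [evalAt_leadingMinor]
  rw [← Matrix.det_mul]
  congr 1
  ext p q
  simp only [Matrix.submatrix_apply, Matrix.mul_apply]
  rw [← Finset.sum_subset (Finset.subset_univ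
    (Finset.univ.map (Fin.castLEEmb (Nat.succ_le_of_lt i.isLt))))]
  · rw [Finset.sum_map]
    rfl
  · intro k _ hk
    rw [hb, mul_zero]
    by_contra h
    refine hk (Finset.mem_map.2 ⟨⟨k, ?_⟩, Finset.mem_univ _, rfl⟩)
    have := q.isLt
    simp only [id, Fin.lt_def, Fin.val_castLE] at h
    lia

theorem evalAt_transpose_leadingMinor (M : Matrix (Fin n) (Fin n) ℂ) (i : Fin n) :
    evalAt M.transpose (leadingMinor i) = evalAt M (leadingMinor i) := by
  rw [evalAt_leadingMinor, evalAt_leadingMinor, ← Matrix.det_transpose]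
  rfl

theorem evalAt_highestWeightVector_mul (lam : Fin n → ℕ) (M : Matrix (Fin n) (Fin n) ℂ)
    {b : Matrix (Fin n) (Fin n) ℂ} (hb : b.BlockTriangular id) :
    evalAt (M * b) (highestWeightVector lam) =
      evalAt b (highestWeightVector lam) * evalAt M (highestWeightVector lam) := by
  simp only [highestWeightVector, map_prod, map_pow, evalAt_leadingMinor_mul M hb, mul_pow,
    Finset.prod_mul_distrib]
  ring

theorem evalAt_transpose_highestWeightVector (lam : Fin n → ℕ) (M : Matrix (Fin n) (Fin n) ℂ) :
    evalAt M.transpose (highestWeightVector lam) = evalAt M (highestWeightVector lam) := by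
  simp only [highestWeightVector, map_prod, map_pow, evalAt_transpose_leadingMinor]

theorem evalAt_conjTranspose_highestWeightVector (lam : Fin n → ℕ)
    (M : Matrix (Fin n) (Fin n) ℂ) :
    evalAt M.conjTranspose (highestWeightVector lam) =
      starRingEnd ℂ (evalAt M (highestWeightVector lam)) := by
  rw [show M.conjTranspose = (M.map star).transpose from rfl,
    evalAt_transpose_highestWeightVector]
  simp only [highestWeightVector, map_prod, map_pow, evalAt_leadingMinor]
  refine Finset.prod_congr rfl fun i _ => ?_
  rw [RingHom.map_det]
  rfl

theorem evalAt_one_highestWeightVector (lam : Fin n → ℕ) :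
    evalAt 1 (highestWeightVector lam) = 1 := by
  simp only [highestWeightVector, map_prod, map_pow, evalAt_leadingMinor]
  refine Finset.prod_eq_one fun i _ => ?_
  rw [Matrix.submatrix_one _ (Fin.castLE_injective _), Matrix.det_one, one_pow]

theorem highestWeightVector_ne_zero (lam : Fin n → ℕ) : highestWeightVector lam ≠ 0 := by
  intro h
  have := evalAt_one_highestWeightVector lam
  rw [h, map_zero] at this
  exact zero_ne_one this

/-- A polynomial function on `ι × n` matrices is a highest weight vector of weight `lam` if upper
triangular invertible matrices act on it by the corresponding character. -/
def IsHighestWeight (lam : Fin n → ℕ) (w : MvPolynomial (ι × Fin n) ℂ) : Prop :=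
  ∀ b : Matrix (Fin n) (Fin n) ℂ, b.BlockTriangular id → b.det ≠ 0 →
    act b w = evalAt b (highestWeightVector lam) • w

theorem isHighestWeight_highestWeightVector (lam : Fin n → ℕ) :
    IsHighestWeight lam (highestWeightVector lam) := fun b hb _ =>
  eq_of_evalAt fun M => by
    rw [evalAt_act, evalAt_highestWeightVector_mul lam M hb, map_smul, smul_eq_mul]

/-- LU decomposition. -/
theorem exists_lower_mul_upper : ∀ {n : ℕ} (x : Matrix (Fin n) (Fin n) ℂ),
    (∀ i : Fin n, evalAt x (leadingMinor i) ≠ 0) →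
    ∃ l u : Matrix (Fin n) (Fin n) ℂ,
      l.transpose.BlockTriangular id ∧ u.BlockTriangular id ∧ x = l * u
  | 0, x, _ => ⟨1, x, by rw [Matrix.transpose_one]; exact Matrix.blockTriangular_one,
      fun i => i.elim0, (one_mul x).symm⟩
  | n + 1, x, hx => by
    have hsub : ∀ i : Fin n, evalAt (x.submatrix Fin.castSucc Fin.castSucc) (leadingMinor i) =
        evalAt x (leadingMinor i.castSucc) := by
      intro i
      rw [evalAt_leadingMinor, evalAt_leadingMinor]
      rfl
    obtain ⟨l, u, hl, hu, hlu⟩ :=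
      exists_lower_mul_upper (x.submatrix Fin.castSucc Fin.castSucc) fun i => by
        rw [hsub]
        exact hx _
    -- The block of size $n$ is itself a leading block of $x$, so its factors are invertible and the
    -- bordering row and column can be solved for. The new corner of `u` is the Schur complement.
    have hdet : (l * u).det ≠ 0 := by
      rw [← hlu]
      cases n with
      | zero => simp
      | succ m =>
        have := hx (Fin.last m).castSucc
        rwa [← hsub, evalAt_leadingMinor] at this
    rw [Matrix.det_mul] at hdet
    have hdl : IsUnit l.det := (left_ne_zero_of_mul hdet).isUnit
    have hdu : IsUnit u.det := (right_ne_zero_of_mul hdet).isUnit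
    set c : Fin n → ℂ := l⁻¹.mulVec fun i => x i.castSucc (Fin.last n) with hc
    set r : Fin n → ℂ := Matrix.vecMul (fun j => x (Fin.last n) j.castSucc) u⁻¹ with hr
    have hlc : l.mulVec c = fun i => x i.castSucc (Fin.last n) := by
      rw [hc, Matrix.mulVec_mulVec, Matrix.mul_nonsing_inv _ hdl, Matrix.one_mulVec]
    have hru : Matrix.vecMul r u = fun j => x (Fin.last n) j.castSucc := by
      rw [hr, Matrix.vecMul_vecMul, Matrix.nonsing_inv_mul _ hdu, Matrix.vecMul_one]
    refine ⟨Matrix.of fun i j => Fin.lastCases (Fin.lastCases 1 r j)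
        (fun i => Fin.lastCases 0 (l i) j) i,
      Matrix.of fun i j => Fin.lastCases
        (Fin.lastCases (x (Fin.last n) (Fin.last n) - r ⬝ᵥ c) (fun _ => 0) j)
        (fun i => Fin.lastCases (c i) (u i) j) i, ?_, ?_, ?_⟩
    · intro i j hij
      induction i using Fin.lastCases with
      | last =>
        induction j using Fin.lastCases with
        | last => simp at hij
        | cast j => simp
      | cast i =>
        induction j using Fin.lastCases with
        | last => simp [Fin.lt_def] at hij; lia
        | cast j => simpa using hl (show id j < id i by simpa using hij)
    · intro i j hij
      induction i using Fin.lastCases with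
      | last =>
        induction j using Fin.lastCases with
        | last => simp at hij
        | cast j => simp
      | cast i =>
        induction j using Fin.lastCases with
        | last => simp [Fin.lt_def] at hij; lia
        | cast j => simpa using hu (show id j < id i by simpa using hij)
    · ext i j
      rw [Matrix.mul_apply, Fin.sum_univ_castSucc]
      induction i using Fin.lastCases with
      | last =>
        induction j using Fin.lastCases with
        | last => simp [dotProduct]
        | cast j => simpa [Matrix.vecMul, dotProduct] using (congrFun hru j).symm
      | cast i =>
        induction j using Fin.lastCases with
        | last => simpa [Matrix.mulVec, dotProduct] using (congrFun hlc i).symm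
        | cast j => simpa [Matrix.mul_apply] using congrFun (congrFun hlu i) j

theorem exists_polynomial_act (x : Matrix (Fin n) (Fin n) ℂ) (f : MvPolynomial (ι × Fin n) ℂ) :
    ∃ P : Polynomial (MvPolynomial (ι × Fin n) ℂ),
      ∀ s : ℂ, P.eval (C s) = act (x + Matrix.scalar _ s) f := by
  refine ⟨aeval (fun p : ι × Fin n => ∑ k, Polynomial.C (X (p.1, k)) *
    (Polynomial.C (C (x k p.2)) + Polynomial.X * Polynomial.C (C ((1 : Matrix _ _ ℂ) k p.2)))) f,
    fun s => ?_⟩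
  induction f using MvPolynomial.induction_on with
  | C a => simp [algHom_C]
  | add p q hp hq => rw [map_add, Polynomial.eval_add, hp, hq, map_add]
  | mul_X p q hp =>
    rw [map_mul, Polynomial.eval_mul, hp, map_mul, aeval_X, act_X, Polynomial.eval_finsetSum]
    congr 1
    refine Finset.sum_congr rfl fun k _ => ?_
    simp only [Polynomial.eval_mul, Polynomial.eval_add, Polynomial.eval_C, Polynomial.eval_X,
      ← C_mul, ← C_add]
    congr 3
    simp [Matrix.one_apply, Matrix.diagonal_apply]

/-- Serves to extend identities from generic matrices to all of them along the line $x+s\cdot1$. -/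
theorem exists_polynomial_fischer_act (w f : MvPolynomial (ι × Fin n) ℂ)
    (x : Matrix (Fin n) (Fin n) ℂ) :
    ∃ P : Polynomial ℂ, ∀ s : ℂ, P.eval s = fischer w (act (x + Matrix.scalar _ s) f) := by
  obtain ⟨P, hP⟩ := exists_polynomial_act x f
  refine ⟨∑ k ∈ P.support, Polynomial.C (fischer w (P.coeff k)) * Polynomial.X ^ k, fun s => ?_⟩
  rw [← hP, Polynomial.eval_eq_sum (p := P), Polynomial.sum, fischer_sum_right, Polynomial.eval_finsetSum]
  refine Finset.sum_congr rfl fun k _ => ?_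
  rw [Polynomial.eval_mul, Polynomial.eval_C, Polynomial.eval_pow, Polynomial.eval_X, ← C_pow,
    mul_comm (P.coeff k), ← smul_eq_C_mul, fischer_smul_right, mul_comm]

theorem finite_setOf_evalAt_leadingMinor_eq_zero (x : Matrix (Fin n) (Fin n) ℂ) :
    {s : ℂ | ∃ i : Fin n, evalAt (x + Matrix.scalar _ s) (leadingMinor i) = 0}.Finite := by
  rw [Set.ofPred_exists]
  refine Set.finite_iUnion fun i => ?_
  set e : Fin (i.val + 1) → Fin n := Fin.castLE (Nat.succ_le_of_lt i.isLt) with he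
  -- A leading minor of $x+s\cdot1$, as a function of $s$, is the characteristic polynomial of minus
  -- the leading block of $x$.
  refine ((-x.submatrix e e).charpoly.rootSet_finite ℂ).subset fun s hs => ?_
  rw [Polynomial.mem_rootSet_of_ne (Matrix.charpoly_monic _).ne_zero, Polynomial.coe_aeval_eq_eval,
    Matrix.eval_charpoly, ← hs, evalAt_leadingMinor]
  congr 1
  ext a b
  simp [Matrix.diagonal_apply, he, add_comm]

/-- The matrix coefficient of a highest weight vector. -/
theorem IsHighestWeight.fischer_act_self [Finite ι] {lam : Fin n → ℕ}
    {w : MvPolynomial (ι × Fin n) ℂ} (hw : IsHighestWeight lam w) (x : Matrix (Fin n) (Fin n) ℂ) :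
    fischer w (act x w) = evalAt x (highestWeightVector lam) * fischer w w := by
  -- For $x=lu$, the factor $u$ acts on the right argument by its character, and $l$ moves to the
  -- left argument as the upper triangular matrix $l^*$, whose character comes out conjugated.
  have hgen : ∀ x : Matrix (Fin n) (Fin n) ℂ, (∀ i, evalAt x (leadingMinor i) ≠ 0) →
      x.det ≠ 0 →
      fischer w (act x w) = evalAt x (highestWeightVector lam) * fischer w w := by
    intro x hx hdx
    obtain ⟨l, u, hl, hu, rfl⟩ := exists_lower_mul_upper x hx
    rw [Matrix.det_mul] at hdx
    have hl' : l.conjTranspose.BlockTriangular id := fun i j hij => by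
      have := hl hij
      rw [Matrix.transpose_apply] at this
      rw [Matrix.conjTranspose_apply, this, star_zero]
    have hdl : l.conjTranspose.det ≠ 0 := by
      rw [Matrix.det_conjTranspose]
      exact star_ne_zero.2 (left_ne_zero_of_mul hdx)
    rw [act_mul_apply, hw u hu (right_ne_zero_of_mul hdx), map_smul, fischer_smul_right,
      ← l.conjTranspose_conjTranspose, ← fischer_act, hw _ hl' hdl, fischer_smul_left,
      evalAt_conjTranspose_highestWeightVector, Complex.conj_conj,
      evalAt_highestWeightVector_mul lam _ hu, l.conjTranspose_conjTranspose]
    ring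
  obtain ⟨P, hP⟩ := exists_polynomial_fischer_act w w x
  obtain ⟨Q, hQ⟩ := exists_polynomial_evalAt
    (x.map Polynomial.C + Matrix.scalar _ Polynomial.X) (highestWeightVector lam)
  have hmap : ∀ s : ℂ, (x.map Polynomial.C + Matrix.scalar _ Polynomial.X).map
      (Polynomial.eval s) = x + Matrix.scalar _ s := by
    intro s
    ext i j
    by_cases h : i = j <;> simp [h]
  have hfin : {s : ℂ | (∃ i : Fin n, evalAt (x + Matrix.scalar _ s) (leadingMinor i) = 0) ∨
      (x + Matrix.scalar _ s).det = 0}.Finite := by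
    refine (finite_setOf_evalAt_leadingMinor_eq_zero x).union ?_
    refine ((-x).charpoly.rootSet_finite ℂ).subset fun s hs => ?_
    rw [Polynomial.mem_rootSet_of_ne (Matrix.charpoly_monic _).ne_zero,
      Polynomial.coe_aeval_eq_eval, Matrix.eval_charpoly, ← hs.out, sub_neg_eq_add, add_comm]
  -- Both sides are polynomials in $s$ agreeing outside a finite set, hence also at $s=0$.
  have hPQ : P = Q * Polynomial.C (fischer w w) := by
    refine Polynomial.eq_of_infinite_eval_eq _ _ (hfin.infinite_compl.mono fun s hs => ?_)
    simp only [Set.mem_compl_iff, Set.mem_ofPred_eq, not_or, not_exists] at hs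
    rw [Set.mem_ofPred_eq, hP, Polynomial.eval_mul, Polynomial.eval_C, hQ, hmap,
      hgen _ hs.1 hs.2]
  have h0 := hP 0
  rw [hPQ, Polynomial.eval_mul, Polynomial.eval_C, hQ, hmap] at h0
  simpa using h0.symm

theorem IsHighestWeight.fischer_act_act [Finite ι] {lam : Fin n → ℕ}
    {w : MvPolynomial (ι × Fin n) ℂ} (hw : IsHighestWeight lam w)
    (g h : Matrix (Fin n) (Fin n) ℂ) :
    fischer (act h w) (act g w) =
      evalAt (h.conjTranspose * g) (highestWeightVector lam) * fischer w w := by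
  rw [fischer_act, ← act_mul_apply, hw.fischer_act_self]

end Triangular

/-! ### Intertwining maps out of `V lam` -/

section Intertwining

variable {ι : Type*} {n : ℕ}

theorem highestWeightVector_mem_V (lam : Fin n → ℕ) :
    highestWeightVector lam ∈ (V lam).toSubmodule :=
  Submodule.subset_span ⟨1, by simp⟩

theorem translationRep_apply (g : GL (Fin n) ℂ) (f : MvPolynomial (Fin n × Fin n) ℂ) :
    translationRep n g f = act (g : Matrix (Fin n) (Fin n) ℂ) f := rfl

theorem V_toSubmodule_eq_range (lam : Fin n → ℕ) :
    (V lam).toSubmodule = LinearMap.range (Finsupp.linearCombination ℂ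
      fun g : GL (Fin n) ℂ => translationRep n g (highestWeightVector lam)) :=
  (Finsupp.range_linearCombination ℂ).symm

/-- The norm of a combination of translates is a universal expression in the weight times the norm
of $w$; whether it vanishes therefore does not depend on the nonzero vector $w$. -/
theorem IsHighestWeight.fischer_linearCombination [Finite ι] {lam : Fin n → ℕ}
    {w : MvPolynomial (ι × Fin n) ℂ} (hw : IsHighestWeight lam w) (c : GL (Fin n) ℂ →₀ ℂ) :
    fischer (Finsupp.linearCombination ℂ
          (fun g : GL (Fin n) ℂ => act (g : Matrix (Fin n) (Fin n) ℂ) w) c)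
        (Finsupp.linearCombination ℂ
          (fun g : GL (Fin n) ℂ => act (g : Matrix (Fin n) (Fin n) ℂ) w) c) =
      (∑ h ∈ c.support, ∑ g ∈ c.support, starRingEnd ℂ (c h) * (c g *
        evalAt ((h : Matrix (Fin n) (Fin n) ℂ).conjTranspose * (g : Matrix (Fin n) (Fin n) ℂ))
          (highestWeightVector lam))) * fischer w w := by
  simp only [Finsupp.linearCombination_apply, Finsupp.sum, fischer_sum_left, Finset.sum_mul]
  refine Finset.sum_congr rfl fun h _ => ?_
  rw [fischer_sum_right]
  refine Finset.sum_congr rfl fun g _ => ?_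
  rw [fischer_smul_left, fischer_smul_right, hw.fischer_act_act]
  ring

/-- Linear relations between the translates of the highest weight vector of `V lam` hold for every
highest weight vector of weight `lam`. -/
theorem IsHighestWeight.linearCombination_eq_zero [Finite ι] {lam : Fin n → ℕ}
    {w : MvPolynomial (ι × Fin n) ℂ} (hw : IsHighestWeight lam w) (c : GL (Fin n) ℂ →₀ ℂ)
    (hc : Finsupp.linearCombination ℂ
      (fun g : GL (Fin n) ℂ => translationRep n g (highestWeightVector lam)) c = 0) :
    Finsupp.linearCombination ℂ
      (fun g : GL (Fin n) ℂ => act (g : Matrix (Fin n) (Fin n) ℂ) w) c = 0 := by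
  refine fischer_self_eq_zero ?_
  have h1 := (isHighestWeight_highestWeightVector lam).fischer_linearCombination c
  simp only [translationRep_apply] at hc
  rw [hc, fischer_zero_right] at h1
  rw [hw.fischer_linearCombination, (mul_eq_zero.1 h1.symm).resolve_right
    fun h => highestWeightVector_ne_zero lam (fischer_self_eq_zero h), zero_mul]

/-- An intertwining map out of a cyclic representation is given by the image of the generator,
which has to satisfy the same linear relations. -/
theorem exists_intertwiningMap_of_cyclic {G E M P : Type*} [Group G] [AddCommGroup E] [Module ℂ E]
    [AddCommMonoid M] [Module ℂ M] [AddCommGroup P] [Module ℂ P] {σ : Representation ℂ G E}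
    (W : Subrepresentation σ) (ρ : Representation ℂ G M) (j : M →ₗ[ℂ] P)
    (hj : Function.Injective j) {v : E} (w : M) (hv : v ∈ W.toSubmodule)
    (hW : W.toSubmodule = LinearMap.range (Finsupp.linearCombination ℂ fun g => σ g v))
    (hker : ∀ c, Finsupp.linearCombination ℂ (fun g => σ g v) c = 0 →
      j (Finsupp.linearCombination ℂ (fun g => ρ g w) c) = 0) :
    ∃ T : Representation.IntertwiningMap W.toRepresentation ρ, T ⟨v, hv⟩ = w := by
  set L := Finsupp.linearCombination ℂ fun g => σ g v with hL
  set R := Finsupp.linearCombination ℂ fun g => ρ g w with hR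
  let T₀ : LinearMap.range L →ₗ[ℂ] P :=
    (LinearMap.ker L).liftQ (j ∘ₗ R) hker ∘ₗ L.quotKerEquivRange.symm.toLinearMap
  have hT₀ : ∀ c, T₀ ⟨L c, LinearMap.mem_range_self L c⟩ = j (R c) := by
    intro c
    have : L.quotKerEquivRange.symm ⟨L c, LinearMap.mem_range_self L c⟩ =
        (LinearMap.ker L).mkQ c := by
      rw [LinearEquiv.symm_apply_eq]
      rfl
    simp only [T₀, LinearMap.comp_apply, LinearEquiv.coe_coe, this]
    exact Submodule.liftQ_apply _ _ _
  have hT₀j : ∀ x, T₀ x ∈ LinearMap.range j := by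
    rintro ⟨_, c, rfl⟩
    rw [hT₀]
    exact LinearMap.mem_range_self _ _
  let T : W.toSubmodule →ₗ[ℂ] M := (LinearEquiv.ofInjective j hj).symm.toLinearMap ∘ₗ
    T₀.codRestrict _ hT₀j ∘ₗ (LinearEquiv.ofEq _ _ hW).toLinearMap
  have hT : ∀ (c) (e : E) (he : e ∈ W.toSubmodule), e = L c → T ⟨e, he⟩ = R c := by
    rintro c _ _ rfl
    simp only [T, LinearMap.comp_apply, LinearEquiv.coe_coe]
    rw [LinearEquiv.symm_apply_eq]
    exact Subtype.ext (hT₀ c)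
  -- Acting by $g$ is left multiplication by $g$ on the indices of the coefficients, on both sides;
  -- hence the map is equivariant.
  have hgL : ∀ g c, σ g (L c) = L (Finsupp.mapDomain (g * ·) c) := by
    intro g c
    rw [hL, Finsupp.linearCombination_mapDomain, Finsupp.apply_linearCombination]
    congr 2
    ext1 h
    simp [map_mul]
  have hgR : ∀ g c, ρ g (R c) = R (Finsupp.mapDomain (g * ·) c) := by
    intro g c
    rw [hR, Finsupp.linearCombination_mapDomain, Finsupp.apply_linearCombination]
    congr 2
    ext1 h
    simp [map_mul]
  refine ⟨T.intertwiningMap_of_isIntertwiningMap _ _ fun g x => ?_, ?_⟩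
  · obtain ⟨x, hx⟩ := x
    obtain ⟨c, hc⟩ := LinearMap.mem_range.1 (hW ▸ hx)
    rw [hT c x hx hc.symm, hgR]
    refine hT _ _ (W.apply_mem_toSubmodule g hx) ?_
    rw [← hgL, hc]
  · refine (hT (Finsupp.single 1 1) v hv ?_).trans ?_
    · simp [hL]
    · simp [hR]

/-- A highest weight vector of weight `lam` is the image of the highest weight vector of `V lam`
under an intertwining map. -/
theorem exists_intertwiningMap [Finite ι] {M : Type*} [AddCommMonoid M] [Module ℂ M]
    (ρ : Representation ℂ (GL (Fin n) ℂ) M) (j : M →ₗ[ℂ] MvPolynomial (ι × Fin n) ℂ)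
    (hj : Function.Injective j)
    (hjρ : ∀ g m, j (ρ g m) = act (g : Matrix (Fin n) (Fin n) ℂ) (j m))
    {lam : Fin n → ℕ} (w : M) (hw : IsHighestWeight lam (j w)) :
    ∃ T : Representation.IntertwiningMap (V lam).toRepresentation ρ,
      T ⟨highestWeightVector lam, highestWeightVector_mem_V lam⟩ = w := by
  refine exists_intertwiningMap_of_cyclic _ ρ j hj w _ (V_toSubmodule_eq_range lam) fun c hc => ?_
  rw [← hw.linearCombination_eq_zero c hc, Finsupp.apply_linearCombination]
  congr 2
  ext1 g
  exact hjρ g w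

theorem intertwiningMap_ext {M : Type*} [AddCommMonoid M] [Module ℂ M]
    {ρ : Representation ℂ (GL (Fin n) ℂ) M} {lam : Fin n → ℕ}
    {T T' : Representation.IntertwiningMap (V lam).toRepresentation ρ}
    (h : T ⟨highestWeightVector lam, highestWeightVector_mem_V lam⟩ =
      T' ⟨highestWeightVector lam, highestWeightVector_mem_V lam⟩) : T = T' := by
  apply Representation.IntertwiningMap.ext
  have key : (V lam).toSubmodule ≤
      (LinearMap.eqLocus T.toLinearMap T'.toLinearMap).map (V lam).toSubmodule.subtype := by
    refine Submodule.span_le.2 ?_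
    rintro _ ⟨g, rfl⟩
    refine ⟨(V lam).toRepresentation g
      ⟨highestWeightVector lam, highestWeightVector_mem_V lam⟩, ?_, rfl⟩
    exact (Representation.IntertwiningMap.isIntertwining _ _ T g _).trans
      ((congrArg (ρ g) h).trans
        (Representation.IntertwiningMap.isIntertwining _ _ T' g _).symm)
  refine LinearMap.ext fun ⟨v, hv⟩ => ?_
  obtain ⟨v', hv', rfl⟩ := key hv
  exact hv'

end Intertwining
end LRCone

namespace LRCone

open MvPolynomial TensorProduct

/-! ### Polynomial functions of the first row and of the first three rows of a `4 × 4` matrix -/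

section Rows

variable {ι : Type*}

/-- The generic `4 × 4` matrix with rows selected by `e`. -/
noncomputable def genericRows (e : Fin 4 → ι) :
    Matrix (Fin 4) (Fin 4) (MvPolynomial (ι × Fin 4) ℂ) :=
  Matrix.of fun i j => X (e i, j)

/-- The entries of the first row. -/
noncomputable def rowVec (e : Fin 4 → ι) (j : Fin 4) : MvPolynomial (ι × Fin 4) ℂ := X (e 0, j)

/-- The signed `3 × 3` minors of the first three rows. -/
noncomputable def coVec (e : Fin 4 → ι) (j : Fin 4) : MvPolynomial (ι × Fin 4) ℂ :=
  (genericRows e).adjugate j 3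

/-- The span of the entries of the first row. -/
noncomputable def rowSpan (e : Fin 4 → ι) : Submodule ℂ (MvPolynomial (ι × Fin 4) ℂ) :=
  Submodule.span ℂ (Set.range (rowVec e))

/-- The span of the `3 × 3` minors of the first three rows. -/
noncomputable def coSpan (e : Fin 4 → ι) : Submodule ℂ (MvPolynomial (ι × Fin 4) ℂ) :=
  Submodule.span ℂ (Set.range (coVec e))

theorem rowVec_mem (e : Fin 4 → ι) (j : Fin 4) : rowVec e j ∈ rowSpan e :=
  Submodule.subset_span ⟨j, rfl⟩

theorem coVec_mem (e : Fin 4 → ι) (j : Fin 4) : coVec e j ∈ coSpan e :=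
  Submodule.subset_span ⟨j, rfl⟩

theorem evalAt_rowVec (M : Matrix ι (Fin 4) ℂ) (e : Fin 4 → ι) (j : Fin 4) :
    evalAt M (rowVec e j) = M (e 0) j := evalAt_X _ _

theorem evalAt_coVec (M : Matrix ι (Fin 4) ℂ) (e : Fin 4 → ι) (j : Fin 4) :
    evalAt M (coVec e j) = (M.submatrix e id).adjugate j 3 := by
  have h := RingHom.map_adjugate (evalAt M : MvPolynomial (ι × Fin 4) ℂ →+* ℂ) (genericRows e)
  have h2 : RingHom.mapMatrix (evalAt M : MvPolynomial (ι × Fin 4) ℂ →+* ℂ) (genericRows e) =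
      M.submatrix e id := by
    ext i j
    simp [genericRows]
  rw [h2] at h
  exact congrFun (congrFun h j) 3

theorem act_rowVec (A : Matrix (Fin 4) (Fin 4) ℂ) (e : Fin 4 → ι) (j : Fin 4) :
    act A (rowVec e j) = ∑ k, A k j • rowVec e k := by
  rw [rowVec, act_X]
  refine Finset.sum_congr rfl fun k _ => ?_
  rw [smul_eq_C_mul, mul_comm, rowVec]

/-- The adjugate reverses products, so the column of minors of $MA$ is $\operatorname{adj}(A)$
applied to that of $M$: minors transform as covectors, up to the determinant. -/
theorem act_coVec [Finite ι] (A : Matrix (Fin 4) (Fin 4) ℂ) (e : Fin 4 → ι) (j : Fin 4) :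
    act A (coVec e j) = ∑ k, A.adjugate j k • coVec e k :=
  eq_of_evalAt fun M => by
    rw [evalAt_act, evalAt_coVec, map_sum]
    have : (M * A).submatrix e id = M.submatrix e id * A := rfl
    rw [this, Matrix.adjugate_mul_distrib, Matrix.mul_apply]
    simp only [map_smul, evalAt_coVec, smul_eq_mul]

theorem map_act_rowSpan_le (A : Matrix (Fin 4) (Fin 4) ℂ) (e : Fin 4 → ι) :
    (rowSpan e).map (act A).toLinearMap ≤ rowSpan e := by
  rw [rowSpan, Submodule.map_span_le]
  rintro _ ⟨j, rfl⟩
  rw [AlgHom.toLinearMap_apply, act_rowVec]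
  exact Submodule.sum_smul_mem _ _ fun k _ => rowVec_mem e k

theorem map_act_coSpan_le [Finite ι] (A : Matrix (Fin 4) (Fin 4) ℂ) (e : Fin 4 → ι) :
    (coSpan e).map (act A).toLinearMap ≤ coSpan e := by
  rw [coSpan, Submodule.map_span_le]
  rintro _ ⟨j, rfl⟩
  rw [AlgHom.toLinearMap_apply, act_coVec]
  exact Submodule.sum_smul_mem _ _ fun k _ => coVec_mem e k

theorem act_mem_pow_mul_pow [Finite ι] (A : Matrix (Fin 4) (Fin 4) ℂ) (e : Fin 4 → ι) (a b : ℕ)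
    {f : MvPolynomial (ι × Fin 4) ℂ} (hf : f ∈ rowSpan e ^ a * coSpan e ^ b) :
    act A f ∈ rowSpan e ^ a * coSpan e ^ b := by
  have h : (rowSpan e ^ a * coSpan e ^ b).map (act A).toLinearMap ≤
      rowSpan e ^ a * coSpan e ^ b := by
    rw [Submodule.map_mul, Submodule.map_pow, Submodule.map_pow]
    exact mul_le_mul' (pow_le_pow_left' (map_act_rowSpan_le A e) a)
      (pow_le_pow_left' (map_act_coSpan_le A e) b)
  exact h ⟨f, hf, rfl⟩

theorem fg_rowSpan (e : Fin 4 → ι) : (rowSpan e).FG := Submodule.fg_span (Set.finite_range _)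

theorem fg_coSpan (e : Fin 4 → ι) : (coSpan e).FG := Submodule.fg_span (Set.finite_range _)

end Rows

/-! ### The representations of near-rectangular highest weight -/

section NearRectangular

/-- The near-rectangular partition `(a + b, b, b, 0)`. -/
def nearRect (a b : ℕ) : Fin 4 → ℕ := ![a + b, b, b, 0]

theorem leadingMinor_zero_eq : (leadingMinor 0 : MvPolynomial (Fin 4 × Fin 4) ℂ) = rowVec id 0 :=
  eq_of_evalAt fun M => by
    rw [evalAt_leadingMinor, evalAt_rowVec]
    exact Matrix.det_fin_one _

theorem leadingMinor_two_eq : (leadingMinor 2 : MvPolynomial (Fin 4 × Fin 4) ℂ) = coVec id 3 :=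
  eq_of_evalAt fun M => by
    rw [evalAt_leadingMinor, evalAt_coVec, Matrix.adjugate_fin_succ_eq_det_submatrix]
    have : (M.submatrix id id).submatrix (Fin.succAbove 3) (Fin.succAbove 3) =
        M.submatrix (Fin.castLE (Nat.succ_le_of_lt (2 : Fin 4).isLt))
          (Fin.castLE (Nat.succ_le_of_lt (2 : Fin 4).isLt)) := by
      ext i j
      fin_cases i <;> fin_cases j <;> rfl
    rw [this]
    norm_num

theorem highestWeightVector_nearRect (a b : ℕ) :
    highestWeightVector (nearRect a b) = rowVec id 0 ^ a * coVec id 3 ^ b := by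
  rw [highestWeightVector, Fin.prod_univ_four, ← leadingMinor_zero_eq, ← leadingMinor_two_eq]
  simp [nearRect]

theorem highestWeightVector_nearRect_mem (a b : ℕ) :
    highestWeightVector (nearRect a b) ∈ rowSpan (id : Fin 4 → Fin 4) ^ a * coSpan id ^ b := by
  rw [highestWeightVector_nearRect]
  exact Submodule.mul_mem_mul (Submodule.pow_mem_pow _ (rowVec_mem _ _) _)
    (Submodule.pow_mem_pow _ (coVec_mem _ _) _)

theorem V_nearRect_le (a b : ℕ) :
    (V (nearRect a b)).toSubmodule ≤ rowSpan (id : Fin 4 → Fin 4) ^ a * coSpan id ^ b := by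
  refine Submodule.span_le.2 ?_
  rintro _ ⟨g, rfl⟩
  exact act_mem_pow_mul_pow _ _ _ _ (highestWeightVector_nearRect_mem a b)

instance finiteDimensional_V_nearRect (a b : ℕ) :
    FiniteDimensional ℂ (V (nearRect a b)).toSubmodule := by
  have h : (rowSpan (id : Fin 4 → Fin 4) ^ a * coSpan id ^ b).FG :=
    ((fg_rowSpan _).pow _).mul ((fg_coSpan _).pow _)
  have := Module.Finite.iff_fg.2 h
  exact Submodule.finiteDimensional_of_le (V_nearRect_le a b)

/-- A regular dominant one-parameter direction of the torus: the extremal vectors are its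
eigenvectors of largest eigenvalue. -/
noncomputable def gradingMatrix : Matrix (Fin 4) (Fin 4) ℂ := Matrix.diagonal ![4, 2, 2, 1]

/-- Sums of a multiple of `Δ` and of eigenvectors of smaller eigenvalue vanishing at `1`. -/
noncomputable def gradedSpan (κ : ℝ) (Δ : MvPolynomial (Fin 4 × Fin 4) ℂ) :
    Submodule ℂ (MvPolynomial (Fin 4 × Fin 4) ℂ) :=
  Submodule.span ℂ ({Δ} ∪ {f | evalAt 1 f = 0 ∧
    ∃ θ : ℝ, 0 ≤ θ ∧ θ < κ ∧ act gradingMatrix f = (θ : ℂ) • f})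

/-- Eigenvalues and values at the identity are multiplicative. The condition $0\le\theta$ is what
keeps a product of smaller eigenvalues strictly below $\kappa_1\kappa_2$. -/
theorem gradedSpan_mul_le {κ₁ κ₂ : ℝ} {Δ₁ Δ₂ : MvPolynomial (Fin 4 × Fin 4) ℂ}
    (hκ₁ : 0 < κ₁) (hκ₂ : 0 < κ₂) (h₁ : act gradingMatrix Δ₁ = (κ₁ : ℂ) • Δ₁)
    (h₂ : act gradingMatrix Δ₂ = (κ₂ : ℂ) • Δ₂) :
    gradedSpan κ₁ Δ₁ * gradedSpan κ₂ Δ₂ ≤ gradedSpan (κ₁ * κ₂) (Δ₁ * Δ₂) := by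
  have hact : ∀ {θ₁ θ₂ : ℝ} {f g : MvPolynomial (Fin 4 × Fin 4) ℂ},
      act gradingMatrix f = (θ₁ : ℂ) • f → act gradingMatrix g = (θ₂ : ℂ) • g →
      act gradingMatrix (f * g) = ((θ₁ * θ₂ : ℝ) : ℂ) • (f * g) := by
    intro θ₁ θ₂ f g hf hg
    rw [map_mul, hf, hg, smul_mul_smul_comm, Complex.ofReal_mul]
  rw [gradedSpan, gradedSpan, Submodule.span_mul_span, Submodule.span_le]
  rintro _ ⟨f, hf, g, hg, rfl⟩
  apply Submodule.subset_span
  rcases hf with rfl | ⟨hf, θ₁, h0₁, hlt₁, hf'⟩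
  · rcases hg with rfl | ⟨hg, θ₂, h0₂, hlt₂, hg'⟩
    · exact Or.inl rfl
    · exact Or.inr ⟨by simp [hg], κ₁ * θ₂, by positivity, by gcongr, hact h₁ hg'⟩
  · rcases hg with rfl | ⟨hg, θ₂, h0₂, hlt₂, hg'⟩
    · exact Or.inr ⟨by simp [hf], θ₁ * κ₂, by positivity, by gcongr, hact hf' h₂⟩
    · exact Or.inr ⟨by simp [hf], θ₁ * θ₂, by positivity,
        mul_lt_mul'' hlt₁ hlt₂ h0₁ h0₂, hact hf' hg'⟩

theorem act_pow_eq {κ : ℝ} {Δ : MvPolynomial (Fin 4 × Fin 4) ℂ}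
    (h : act gradingMatrix Δ = (κ : ℂ) • Δ) (a : ℕ) :
    act gradingMatrix (Δ ^ a) = ((κ ^ a : ℝ) : ℂ) • Δ ^ a := by
  rw [map_pow, h, smul_pow, Complex.ofReal_pow]

theorem gradedSpan_pow_le {κ : ℝ} {Δ : MvPolynomial (Fin 4 × Fin 4) ℂ} (hκ : 0 < κ)
    (h : act gradingMatrix Δ = (κ : ℂ) • Δ) (a : ℕ) :
    gradedSpan κ Δ ^ a ≤ gradedSpan (κ ^ a) (Δ ^ a) := by
  induction a with
  | zero =>
    rw [pow_zero, pow_zero, pow_zero, Submodule.one_le]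
    exact Submodule.subset_span (Or.inl rfl)
  | succ a ih =>
    rw [pow_succ, pow_succ, pow_succ]
    exact (mul_le_mul' ih le_rfl).trans
      (gradedSpan_mul_le (pow_pos hκ a) hκ (act_pow_eq h a) h)

theorem act_gradingMatrix_rowVec (j : Fin 4) :
    act gradingMatrix (rowVec (id : Fin 4 → Fin 4) j) =
      ((![4, 2, 2, 1] j : ℝ) : ℂ) • rowVec id j := by
  rw [act_rowVec, Finset.sum_eq_single j]
  · rw [gradingMatrix, Matrix.diagonal_apply_eq]
    fin_cases j <;> simp
  · intro k _ hk
    rw [gradingMatrix, Matrix.diagonal_apply_ne _ hk, zero_smul]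
  · simp

theorem act_gradingMatrix_coVec (j : Fin 4) :
    act gradingMatrix (coVec (id : Fin 4 → Fin 4) j) =
      ((![4, 8, 8, 16] j : ℝ) : ℂ) • coVec id j := by
  rw [act_coVec, gradingMatrix, Matrix.adjugate_diagonal, Finset.sum_eq_single j]
  · rw [Matrix.diagonal_apply_eq]
    have h := Finset.mul_prod_erase Finset.univ (![4, 2, 2, 1] : Fin 4 → ℂ) (Finset.mem_univ j)
    rw [Fin.prod_univ_four] at h
    congr 1
    fin_cases j <;> simp at h ⊢
    · linear_combination h / 4
    · linear_combination h / 2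
    · linear_combination h / 2
    · linear_combination h
  · intro k _ hk
    rw [Matrix.diagonal_apply_ne _ hk.symm, zero_smul]
  · simp

theorem rowSpan_le_gradedSpan : rowSpan (id : Fin 4 → Fin 4) ≤ gradedSpan 4 (rowVec id 0) := by
  refine Submodule.span_mono ?_
  rintro _ ⟨j, rfl⟩
  by_cases hj : j = 0
  · exact Or.inl (by rw [hj]; rfl)
  · refine Or.inr ⟨by rw [evalAt_rowVec]; exact Matrix.one_apply_ne (Ne.symm hj), _, ?_, ?_,
      act_gradingMatrix_rowVec j⟩ <;>
    fin_cases j <;> simp at hj ⊢ <;> norm_num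

theorem coSpan_le_gradedSpan : coSpan (id : Fin 4 → Fin 4) ≤ gradedSpan 16 (coVec id 3) := by
  refine Submodule.span_mono ?_
  rintro _ ⟨j, rfl⟩
  by_cases hj : j = 3
  · exact Or.inl (by rw [hj]; rfl)
  · refine Or.inr ⟨?_, _, ?_, ?_, act_gradingMatrix_coVec j⟩
    · rw [evalAt_coVec, Matrix.submatrix_id_id, Matrix.adjugate_one]
      exact Matrix.one_apply_ne hj
    all_goals fin_cases j <;> simp at hj ⊢ <;> norm_num

theorem act_gradingMatrix_highestWeightVector (a b : ℕ) :
    act gradingMatrix (rowVec id 0 ^ a * coVec (id : Fin 4 → Fin 4) 3 ^ b) =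
      ((4 ^ a * 16 ^ b : ℝ) : ℂ) • (rowVec id 0 ^ a * coVec id 3 ^ b) := by
  rw [map_mul, act_pow_eq (κ := 4) (by simpa using act_gradingMatrix_rowVec 0),
    act_pow_eq (κ := 16) (by simpa using act_gradingMatrix_coVec 3), smul_mul_smul_comm,
    ← Complex.ofReal_mul]

/-- The highest weight vector is a reproducing kernel at the identity. The grading operator is
self-adjoint and $\Delta^\lambda$ spans its top eigenspace here, so every other eigenvector in the
span is orthogonal to $\Delta^\lambda$; it also vanishes at the identity. -/
theorem fischer_highestWeightVector_nearRect {a b : ℕ} {f : MvPolynomial (Fin 4 × Fin 4) ℂ}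
    (hf : f ∈ rowSpan (id : Fin 4 → Fin 4) ^ a * coSpan id ^ b) :
    fischer (highestWeightVector (nearRect a b)) f = evalAt 1 f *
      fischer (highestWeightVector (nearRect a b)) (highestWeightVector (nearRect a b)) := by
  have h1 : f ∈ gradedSpan (4 ^ a * 16 ^ b) (highestWeightVector (nearRect a b)) := by
    have hx : act gradingMatrix (rowVec (id : Fin 4 → Fin 4) 0) = ((4 : ℝ) : ℂ) • rowVec id 0 := by
      simpa using act_gradingMatrix_rowVec 0
    have hc : act gradingMatrix (coVec (id : Fin 4 → Fin 4) 3) = ((16 : ℝ) : ℂ) • coVec id 3 := by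
      simpa using act_gradingMatrix_coVec 3
    rw [highestWeightVector_nearRect]
    refine gradedSpan_mul_le (by positivity) (by positivity) (act_pow_eq hx a) (act_pow_eq hc b) ?_
    have hle := mul_le_mul' ((pow_le_pow_left' rowSpan_le_gradedSpan a).trans
        (gradedSpan_pow_le (by norm_num) hx a)) ((pow_le_pow_left' coSpan_le_gradedSpan b).trans
        (gradedSpan_pow_le (by norm_num) hc b))
    exact hle hf
  clear hf
  induction h1 using Submodule.span_induction with
  | mem f hf =>
    rcases hf with rfl | ⟨hf, θ, _, hθ, hθf⟩
    · rw [evalAt_one_highestWeightVector, one_mul]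
    · have hself : gradingMatrix.conjTranspose = gradingMatrix := by
        rw [gradingMatrix, Matrix.diagonal_conjTranspose]
        congr 1
        ext j
        fin_cases j <;> simp
      have h := fischer_act gradingMatrix (highestWeightVector (nearRect a b)) f
      rw [hself, hθf, highestWeightVector_nearRect, act_gradingMatrix_highestWeightVector,
        fischer_smul_left, fischer_smul_right, Complex.conj_ofReal, ← sub_eq_zero, ← sub_mul,
        ← Complex.ofReal_sub, mul_eq_zero, Complex.ofReal_eq_zero] at h
      rw [highestWeightVector_nearRect, hf, zero_mul]
      exact h.resolve_left (sub_ne_zero.2 hθ.ne')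
  | zero => simp [fischer_zero_right]
  | add f g _ _ hf hg => rw [fischer_add_right, hf, hg, map_add, add_mul]
  | smul r f _ hf => rw [fischer_smul_right, hf, map_smul, smul_eq_mul, mul_assoc]

/-- `V (a + b, b, b, 0)` is the space of all polynomials of degree `a` in the first row and of
degree `b` in the `3 × 3` minors of the first three rows. -/
theorem V_nearRect (a b : ℕ) :
    (V (nearRect a b)).toSubmodule = rowSpan (id : Fin 4 → Fin 4) ^ a * coSpan id ^ b := by
  refine le_antisymm (V_nearRect_le a b)
    (le_of_fischer_orthogonal (V_nearRect_le a b) fun f hf horth => ?_)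
  -- The product of $f$ with the translate of $\Delta^\lambda$ by $g^*$ is $f(g)$ times a nonzero
  -- constant, so orthogonality to `V` means vanishing on the whole group.
  have hGL : ∀ g : GL (Fin 4) ℂ, evalAt (g : Matrix (Fin 4) (Fin 4) ℂ) f = 0 := by
    intro g
    have hmem : act (g : Matrix (Fin 4) (Fin 4) ℂ).conjTranspose
        (highestWeightVector (nearRect a b)) ∈ (V (nearRect a b)).toSubmodule :=
      Submodule.subset_span ⟨star g, rfl⟩
    have h1 := horth _ hmem
    rw [fischer_act, Matrix.conjTranspose_conjTranspose,
      fischer_highestWeightVector_nearRect (act_mem_pow_mul_pow _ _ _ _ hf), evalAt_act,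
      Matrix.one_mul] at h1
    exact (mul_eq_zero.1 h1).resolve_right
      fun h => highestWeightVector_ne_zero _ (fischer_self_eq_zero h)
  -- Multiplying by the determinant removes the restriction to invertible matrices.
  have hdet : f * Matrix.det (Matrix.mvPolynomialX (Fin 4) (Fin 4) ℂ) = 0 := by
    refine eq_of_evalAt fun M => ?_
    rw [map_mul, map_zero, AlgHom.map_det]
    have hM : (evalAt M).mapMatrix (Matrix.mvPolynomialX (Fin 4) (Fin 4) ℂ) = M := by
      ext i j
      simp
    rw [hM]
    by_cases h : M.det = 0
    · rw [h, mul_zero]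
    · have hM := hGL (Matrix.GeneralLinearGroup.mkOfDetNeZero M h)
      rw [show evalAt M f = 0 from hM, zero_mul]
  exact (mul_eq_zero.1 hdet).resolve_right (Matrix.det_mvPolynomialX_ne_zero _ _)

end NearRectangular

/-! ### Tensor products -/

section Tensor

variable {n : ℕ}

/-- Polynomial functions on pairs of matrices. -/
noncomputable def pairEquiv (n : ℕ) :
    MvPolynomial (Fin n × Fin n) ℂ ⊗[ℂ] MvPolynomial (Fin n × Fin n) ℂ ≃ₐ[ℂ]
      MvPolynomial ((Fin n ⊕ Fin n) × Fin n) ℂ :=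
  (tensorEquivSum ℂ (Fin n × Fin n) (Fin n × Fin n) ℂ).trans
    (renameEquiv ℂ (Equiv.sumProdDistrib _ _ _).symm)

/-- Polynomial functions on a block of rows as polynomial functions on a larger matrix. -/
noncomputable def renameRows {κ ι : Type*} (e : κ → ι) :
    MvPolynomial (κ × Fin n) ℂ →ₐ[ℂ] MvPolynomial (ι × Fin n) ℂ := rename (Prod.map e id)

theorem evalAt_renameRows {κ ι : Type*} (e : κ → ι) (M : Matrix ι (Fin n) ℂ)
    (f : MvPolynomial (κ × Fin n) ℂ) : evalAt M (renameRows e f) = evalAt (M.submatrix e id) f := by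
  rw [renameRows, evalAt, aeval_rename]
  rfl

theorem act_renameRows {κ ι : Type*} [Finite ι] (e : κ → ι) (A : Matrix (Fin n) (Fin n) ℂ)
    (f : MvPolynomial (κ × Fin n) ℂ) : act A (renameRows e f) = renameRows e (act A f) :=
  eq_of_evalAt fun M => by
    rw [evalAt_act, evalAt_renameRows, evalAt_renameRows, evalAt_act]
    rfl

theorem pairEquiv_tmul (f g : MvPolynomial (Fin n × Fin n) ℂ) :
    pairEquiv n (f ⊗ₜ g) = renameRows Sum.inl f * renameRows Sum.inr g := by
  have h1 : (pairEquiv n).toAlgHom.comp Algebra.TensorProduct.includeLeft =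
      renameRows Sum.inl := by
    apply MvPolynomial.algHom_ext
    rintro ⟨i, j⟩
    simp [pairEquiv, renameRows]
  have h2 : (pairEquiv n).toAlgHom.comp Algebra.TensorProduct.includeRight =
      renameRows Sum.inr := by
    apply MvPolynomial.algHom_ext
    rintro ⟨i, j⟩
    simp [pairEquiv, renameRows]
  rw [← h1, ← h2, ← mul_one f, ← one_mul g, ← Algebra.TensorProduct.tmul_mul_tmul, map_mul,
    mul_one, one_mul]
  rfl

theorem renameRows_rowVec {ι : Type*} (e : Fin 4 → ι) (j : Fin 4) :
    renameRows e (rowVec id j) = rowVec e j := by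
  simp [renameRows, rowVec]

theorem renameRows_coVec {ι : Type*} [Finite ι] (e : Fin 4 → ι) (j : Fin 4) :
    renameRows e (coVec id j) = coVec e j :=
  eq_of_evalAt fun M => by
    rw [evalAt_renameRows, evalAt_coVec, evalAt_coVec]
    rfl

theorem map_renameRows {ι : Type*} [Finite ι] (e : Fin 4 → ι) (a b : ℕ) :
    (rowSpan id ^ a * coSpan id ^ b).map (renameRows e).toLinearMap =
      rowSpan e ^ a * coSpan e ^ b := by
  rw [Submodule.map_mul, Submodule.map_pow, Submodule.map_pow, rowSpan, coSpan, rowSpan, coSpan,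
    Submodule.map_span, Submodule.map_span, ← Set.range_comp, ← Set.range_comp]
  congr 3
  · congr 2
    ext1 j
    exact renameRows_rowVec e j
  · congr 2
    ext1 j
    exact renameRows_coVec e j

/-- The realization of `V lam ⊗ V mu` by polynomial functions on pairs of matrices. -/
noncomputable def tensorRealization (lam mu : Fin n → ℕ) :
    (V lam).toSubmodule ⊗[ℂ] (V mu).toSubmodule →ₗ[ℂ]
      MvPolynomial ((Fin n ⊕ Fin n) × Fin n) ℂ :=
  (pairEquiv n).toLinearMap ∘ₗ TensorProduct.mapIncl _ _

theorem tensorRealization_tmul (lam mu : Fin n → ℕ) (f : (V lam).toSubmodule)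
    (g : (V mu).toSubmodule) : tensorRealization lam mu (f ⊗ₜ g) =
      renameRows Sum.inl f.1 * renameRows Sum.inr g.1 :=
  pairEquiv_tmul _ _

theorem tensorRealization_injective (lam mu : Fin n → ℕ) :
    Function.Injective (tensorRealization lam mu) :=
  (pairEquiv n).injective.comp (TensorProduct.map_injective_of_flat_flat _ _
    Subtype.val_injective Subtype.val_injective)

theorem tensorRealization_apply (lam mu : Fin n → ℕ) (g : GL (Fin n) ℂ)
    (w : (V lam).toSubmodule ⊗[ℂ] (V mu).toSubmodule) :
    tensorRealization lam mu (((V lam).toRepresentation.tprod (V mu).toRepresentation) g w) =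
      act (g : Matrix (Fin n) (Fin n) ℂ) (tensorRealization lam mu w) := by
  induction w using TensorProduct.induction_on with
  | zero => simp
  | add x y hx hy => rw [map_add, map_add, hx, hy, map_add, map_add]
  | tmul x y =>
    rw [Representation.tprod_apply, TensorProduct.map_tmul, tensorRealization_tmul,
      tensorRealization_tmul, map_mul, act_renameRows, act_renameRows]
    rfl

theorem range_tensorRealization (lam mu : Fin n → ℕ) :
    LinearMap.range (tensorRealization lam mu) =
      (V lam).toSubmodule.map (renameRows Sum.inl).toLinearMap *
        (V mu).toSubmodule.map (renameRows Sum.inr).toLinearMap := by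
  apply le_antisymm
  · rintro _ ⟨w, rfl⟩
    induction w using TensorProduct.induction_on with
    | zero => rw [map_zero]; exact zero_mem _
    | add x y hx hy => rw [map_add]; exact add_mem hx hy
    | tmul x y =>
      rw [tensorRealization_tmul]
      exact Submodule.mul_mem_mul ⟨_, x.2, rfl⟩ ⟨_, y.2, rfl⟩
  · rw [Submodule.mul_le]
    rintro _ ⟨f, hf, rfl⟩ _ ⟨g, hg, rfl⟩
    exact ⟨⟨f, hf⟩ ⊗ₜ ⟨g, hg⟩, tensorRealization_tmul _ _ _ _⟩

/-- Polynomial functions on pairs of `4 × 4` matrices of the given degrees in the first row and in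
the `3 × 3` minors of the first three rows of both matrices. -/
noncomputable def multidegree (a b c d : ℕ) :
    Submodule ℂ (MvPolynomial ((Fin 4 ⊕ Fin 4) × Fin 4) ℂ) :=
  rowSpan Sum.inl ^ a * coSpan Sum.inl ^ b * (rowSpan Sum.inr ^ c * coSpan Sum.inr ^ d)

theorem range_tensorRealization_nearRect (a b c d : ℕ) :
    LinearMap.range (tensorRealization (nearRect a b) (nearRect c d)) = multidegree a b c d := by
  rw [range_tensorRealization, V_nearRect, V_nearRect, map_renameRows, map_renameRows, multidegree]

end Tensor
end LRCone

namespace LRCone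

open MvPolynomial TensorProduct

/-! ### Littlewood-Richardson coefficients and highest weight vectors -/

section Bridge

variable {a b c d : ℕ} {nu : Fin 4 → ℕ}

/-- The space of highest weight vectors of weight `nu` in `V lam ⊗ V mu`. -/
noncomputable def highestWeightSpace {n : ℕ} (lam mu nu : Fin n → ℕ) :
    Submodule ℂ (MvPolynomial ((Fin n ⊕ Fin n) × Fin n) ℂ) where
  carrier := {f | f ∈ LinearMap.range (tensorRealization lam mu) ∧ IsHighestWeight nu f}
  zero_mem' := ⟨zero_mem _, fun b _ _ => by rw [map_zero, smul_zero]⟩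
  add_mem' hf hg := ⟨add_mem hf.1 hg.1, fun b hb hdet => by
    rw [map_add, hf.2 b hb hdet, hg.2 b hb hdet, smul_add]⟩
  smul_mem' r _ hf := ⟨Submodule.smul_mem _ r hf.1, fun b hb hdet => by
    rw [map_smul, hf.2 b hb hdet, smul_comm]⟩

/-- The highest weight vector attached to an intertwining map. -/
noncomputable def highestWeightOf {n : ℕ} (lam mu nu : Fin n → ℕ) :
    Representation.IntertwiningMap (V nu).toRepresentation
      ((V lam).toRepresentation.tprod (V mu).toRepresentation) →ₗ[ℂ]
      MvPolynomial ((Fin n ⊕ Fin n) × Fin n) ℂ where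
  toFun T := tensorRealization lam mu
    (T ⟨highestWeightVector nu, highestWeightVector_mem_V nu⟩)
  map_add' _ _ := map_add _ _ _
  map_smul' r T := map_smul (tensorRealization lam mu) r
    (T ⟨highestWeightVector nu, highestWeightVector_mem_V nu⟩)

theorem highestWeightOf_injective {n : ℕ} (lam mu nu : Fin n → ℕ) :
    Function.Injective (highestWeightOf lam mu nu) := fun _ _ h =>
  intertwiningMap_ext (tensorRealization_injective lam mu h)

/-- An intertwining map carries the generator to a vector with the same character; conversely such a
vector satisfies the linear relations of the translates of the generator and so defines a map. -/
theorem range_highestWeightOf {n : ℕ} (lam mu nu : Fin n → ℕ) :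
    LinearMap.range (highestWeightOf lam mu nu) = highestWeightSpace lam mu nu := by
  apply le_antisymm
  · rintro _ ⟨T, rfl⟩
    refine ⟨LinearMap.mem_range_self (tensorRealization lam mu) _, fun b hb hdet => ?_⟩
    set g : GL (Fin n) ℂ := Matrix.GeneralLinearGroup.mkOfDetNeZero b hdet with hg
    have h1 : (V nu).toRepresentation g ⟨highestWeightVector nu, highestWeightVector_mem_V nu⟩ =
        evalAt b (highestWeightVector nu) •
          (⟨highestWeightVector nu, highestWeightVector_mem_V nu⟩ : (V nu).toSubmodule) :=
      Subtype.ext (isHighestWeight_highestWeightVector nu b hb hdet)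
    have h2 := tensorRealization_apply lam mu g
      (T ⟨highestWeightVector nu, highestWeightVector_mem_V nu⟩)
    rw [← Representation.IntertwiningMap.isIntertwining _ _ T g, h1, map_smul, map_smul] at h2
    exact h2.symm
  · rintro _ ⟨⟨w, rfl⟩, hw⟩
    obtain ⟨T, hT⟩ := exists_intertwiningMap
      ((V lam).toRepresentation.tprod (V mu).toRepresentation) _
      (tensorRealization_injective lam mu) (tensorRealization_apply lam mu) w hw
    exact ⟨T, congrArg (tensorRealization lam mu) hT⟩

theorem lrCoeff_eq_finrank {n : ℕ} (lam mu nu : Fin n → ℕ) :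
    lrCoeff lam mu nu = Module.finrank ℂ (highestWeightSpace lam mu nu) := by
  rw [← range_highestWeightOf]
  exact (LinearEquiv.ofInjective _ (highestWeightOf_injective lam mu nu)).finrank_eq

theorem mem_highestWeightSpace_nearRect {f : MvPolynomial ((Fin 4 ⊕ Fin 4) × Fin 4) ℂ} :
    f ∈ highestWeightSpace (nearRect a b) (nearRect c d) nu ↔
      f ∈ multidegree a b c d ∧ IsHighestWeight nu f := by
  rw [← range_tensorRealization_nearRect]
  rfl

instance finiteDimensional_highestWeightSpace :
    FiniteDimensional ℂ (highestWeightSpace (nearRect a b) (nearRect c d) nu) := by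
  have h : (multidegree a b c d).FG :=
    (((fg_rowSpan _).pow _).mul ((fg_coSpan _).pow _)).mul
      (((fg_rowSpan _).pow _).mul ((fg_coSpan _).pow _))
  have := Module.Finite.iff_fg.2 h
  exact Submodule.finiteDimensional_of_le fun f hf => (mem_highestWeightSpace_nearRect.1 hf).1

end Bridge

/-! ### The eight covariants -/

section Covariants

/-- The partition with `n i` columns of length `i + 1`. -/
def ofColumns (n : Fin 4 → ℕ) : Fin 4 → ℕ :=
  ![n 0 + n 1 + n 2 + n 3, n 1 + n 2 + n 3, n 2 + n 3, n 3]

theorem evalAt_highestWeightVector_ofColumns (n : Fin 4 → ℕ) {b : Matrix (Fin 4) (Fin 4) ℂ}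
    (hb : b.BlockTriangular id) : evalAt b (highestWeightVector (ofColumns n)) =
      b 0 0 ^ n 0 * (b 0 0 * b 1 1) ^ n 1 * (b 0 0 * b 1 1 * b 2 2) ^ n 2 *
        (b 0 0 * b 1 1 * b 2 2 * b 3 3) ^ n 3 := by
  have h : ∀ i : Fin 4, evalAt b (leadingMinor i) =
      ∏ k : Fin (i.val + 1), b (Fin.castLE i.isLt k) (Fin.castLE i.isLt k) := by
    intro i
    rw [evalAt_leadingMinor, Matrix.det_of_isUpperTriangular]
    · rfl
    · exact fun p q hpq => hb (by simpa using hpq)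
  have e0 : evalAt b (leadingMinor 0) = b 0 0 := by
    rw [h]
    exact Fin.prod_univ_one _
  have e1 : evalAt b (leadingMinor 1) = b 0 0 * b 1 1 := by
    rw [h]
    exact Fin.prod_univ_two _
  have e2 : evalAt b (leadingMinor 2) = b 0 0 * b 1 1 * b 2 2 := by
    rw [h]
    exact Fin.prod_univ_three _
  have e3 : evalAt b (leadingMinor 3) = b 0 0 * b 1 1 * b 2 2 * b 3 3 := by
    rw [h]
    exact Fin.prod_univ_four _
  simp only [highestWeightVector, map_prod, map_pow]
  rw [Fin.prod_univ_four, e0, e1, e2, e3]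
  have s0 : n 0 + n 1 + n 2 + n 3 - (n 1 + n 2 + n 3) = n 0 := by lia
  have s1 : n 1 + n 2 + n 3 - (n 2 + n 3) = n 1 := by lia
  simp [ofColumns, s0, s1]

/-- The eight basic highest weight vectors for pairs of near-rectangular representations. -/
noncomputable def covariant : Fin 8 → MvPolynomial ((Fin 4 ⊕ Fin 4) × Fin 4) ℂ :=
  ![rowVec Sum.inl 0, rowVec Sum.inr 0, coVec Sum.inl 3, coVec Sum.inr 3,
    rowVec Sum.inl 0 * rowVec Sum.inr 1 - rowVec Sum.inl 1 * rowVec Sum.inr 0,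
    ∑ j, rowVec Sum.inl j * coVec Sum.inr j,
    ∑ j, rowVec Sum.inr j * coVec Sum.inl j,
    coVec Sum.inl 2 * coVec Sum.inr 3 - coVec Sum.inl 3 * coVec Sum.inr 2]

/-- Monomials in the eight covariants. -/
noncomputable def covariantMonomial (m : Fin 8 → ℕ) :
    MvPolynomial ((Fin 4 ⊕ Fin 4) × Fin 4) ℂ := ∏ i, covariant i ^ m i

theorem covariantMonomial_mem (m : Fin 8 → ℕ) : covariantMonomial m ∈
    multidegree (m 0 + m 4 + m 5) (m 2 + m 6 + m 7) (m 1 + m 4 + m 6) (m 3 + m 5 + m 7) := by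
  have h : ∏ i, ![rowSpan Sum.inl, rowSpan Sum.inr, coSpan Sum.inl, coSpan Sum.inr,
      rowSpan Sum.inl * rowSpan Sum.inr, rowSpan Sum.inl * coSpan Sum.inr,
      rowSpan Sum.inr * coSpan Sum.inl,
      coSpan (Sum.inl : Fin 4 → Fin 4 ⊕ Fin 4) * coSpan Sum.inr] i ^ m i =
    multidegree (m 0 + m 4 + m 5) (m 2 + m 6 + m 7) (m 1 + m 4 + m 6) (m 3 + m 5 + m 7) := by
    rw [Fin.prod_univ_eight, multidegree]
    simp
    ring
  rw [← h, covariantMonomial, Fin.prod_univ_eight, Fin.prod_univ_eight]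
  have hr := fun e : Fin 4 → Fin 4 ⊕ Fin 4 => rowVec_mem e
  have hc := fun e : Fin 4 → Fin 4 ⊕ Fin 4 => coVec_mem e
  have hrc : ∀ e e' : Fin 4 → Fin 4 ⊕ Fin 4,
      ∑ j, rowVec e j * coVec e' j ∈ rowSpan e * coSpan e' := fun e e' =>
    sum_mem fun j _ => Submodule.mul_mem_mul (hr _ _) (hc _ _)
  refine Submodule.mul_mem_mul (Submodule.mul_mem_mul (Submodule.mul_mem_mul
    (Submodule.mul_mem_mul (Submodule.mul_mem_mul (Submodule.mul_mem_mul (Submodule.mul_mem_mul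
    ?_ ?_) ?_) ?_) ?_) ?_) ?_) ?_ <;> refine Submodule.pow_mem_pow _ ?_ _
  · exact hr _ _
  · exact hr _ _
  · exact hc _ _
  · exact hc _ _
  · exact sub_mem (Submodule.mul_mem_mul (hr _ _) (hr _ _)) (Submodule.mul_mem_mul (hr _ _) (hr _ _))
  · exact hrc _ _
  · exact hrc _ _
  · exact sub_mem (Submodule.mul_mem_mul (hc _ _) (hc _ _)) (Submodule.mul_mem_mul (hc _ _) (hc _ _))

/-- The column multiplicities of the weights of the monomials in the covariants. -/
def columnsOf (m : Fin 8 → ℕ) : Fin 4 → ℕ :=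
  ![m 0 + m 1, m 4 + m 7, m 2 + m 3, m 5 + m 6 + m 7]

/-- The pairing is an entry of $N\operatorname{adj}(N')$; replacing $N,N'$ by $Nb,N'b$ inserts
$b\operatorname{adj}(b)=\det b$. -/
theorem act_contraction (b : Matrix (Fin 4) (Fin 4) ℂ) (e e' : Fin 4 → Fin 4 ⊕ Fin 4) :
    act b (∑ j, rowVec e j * coVec e' j) = b.det • ∑ j, rowVec e j * coVec e' j :=
  eq_of_evalAt fun M => by
    simp only [evalAt_act, map_smul, map_sum, map_mul, evalAt_rowVec, evalAt_coVec]
    have h1 : (M * b).submatrix e' id = M.submatrix e' id * b := rfl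
    have h2 : ∀ N : Matrix (Fin 4 ⊕ Fin 4) (Fin 4) ℂ,
        ∑ j, N (e 0) j * (N.submatrix e' id).adjugate j 3 =
          (N.submatrix e id * (N.submatrix e' id).adjugate) 0 3 := fun N => rfl
    have h3 : (M * b).submatrix e id = M.submatrix e id * b := rfl
    rw [h2, h2, h1, h3, Matrix.adjugate_mul_distrib, Matrix.mul_assoc, ← Matrix.mul_assoc b,
      Matrix.mul_adjugate, smul_mul_assoc, Matrix.one_mul, mul_smul_comm, Matrix.smul_apply]

theorem isHighestWeight_covariantMonomial (m : Fin 8 → ℕ) :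
    IsHighestWeight (ofColumns (columnsOf m)) (covariantMonomial m) := by
  intro b hb _
  have hz : b 1 0 = 0 ∧ b 2 0 = 0 ∧ b 3 0 = 0 ∧ b 2 1 = 0 ∧ b 3 1 = 0 ∧ b 3 2 = 0 :=
    ⟨hb (by decide), hb (by decide), hb (by decide), hb (by decide), hb (by decide),
      hb (by decide)⟩
  obtain ⟨h10, h20, h30, h21, h31, h32⟩ := hz
  have hdet : b.det = b 0 0 * b 1 1 * b 2 2 * b 3 3 := by
    rw [Matrix.det_of_isUpperTriangular hb, Fin.prod_univ_four]
  have r0 : ∀ e : Fin 4 → Fin 4 ⊕ Fin 4, act b (rowVec e 0) = b 0 0 • rowVec e 0 := fun e => by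
    rw [act_rowVec, Fin.sum_univ_four, h10, h20, h30]
    simp
  have r1 : ∀ e : Fin 4 → Fin 4 ⊕ Fin 4,
      act b (rowVec e 1) = b 0 1 • rowVec e 0 + b 1 1 • rowVec e 1 := fun e => by
    rw [act_rowVec, Fin.sum_univ_four, h21, h31]
    simp
  have c3 : ∀ e : Fin 4 → Fin 4 ⊕ Fin 4,
      act b (coVec e 3) = (b 0 0 * b 1 1 * b 2 2) • coVec e 3 := fun e => by
    rw [act_coVec, Fin.sum_univ_four]
    simp [Matrix.adjugate_fin_succ_eq_det_submatrix, Matrix.det_fin_three, Fin.succAbove, h10, h20,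
      h30, h21, h31, h32]
    norm_num
  have c2 : ∀ e : Fin 4 → Fin 4 ⊕ Fin 4, act b (coVec e 2) =
      (b 0 0 * b 1 1 * b 3 3) • coVec e 2 + b.adjugate 2 3 • coVec e 3 := fun e => by
    rw [act_coVec, Fin.sum_univ_four]
    simp [Matrix.adjugate_fin_succ_eq_det_submatrix, Matrix.det_fin_three, Fin.succAbove, h10, h20,
      h30, h21, h31]
    norm_num
  have key : ∀ i, act b (covariant i) = ![b 0 0, b 0 0, b 0 0 * b 1 1 * b 2 2,
      b 0 0 * b 1 1 * b 2 2, b 0 0 * b 1 1, b.det, b.det,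
      b 0 0 * b 1 1 * b.det] i • covariant i := by
    intro i
    fin_cases i
    · exact r0 _
    · exact r0 _
    · exact c3 _
    · exact c3 _
    · simp only [covariant, Fin.reduceFinMk, Matrix.cons_val, map_sub, map_mul, r0, r1, hdet,
        smul_eq_C_mul]
      ring
    · exact act_contraction _ _ _
    · exact act_contraction _ _ _
    · simp only [covariant, Fin.reduceFinMk, Matrix.cons_val, map_sub, map_mul, c2, c3, hdet,
        smul_eq_C_mul]
      ring
  rw [evalAt_highestWeightVector_ofColumns _ hb, covariantMonomial, map_prod]
  simp only [map_pow, key, smul_pow, Finset.prod_smul]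
  congr 1
  rw [Fin.prod_univ_eight]
  simp [columnsOf, hdet]
  ring

end Covariants
end LRCone

namespace LRCone

open MvPolynomial TensorProduct

/-! ### Restriction of highest weight vectors to a slice -/

section Slice

theorem evalAt_mul_of_scaling {ι : Type*} {n : ℕ} {P Q : Submodule ℂ (MvPolynomial (ι × Fin n) ℂ)}
    {M N : Matrix ι (Fin n) ℂ} {r s : ℂ} (hP : ∀ f ∈ P, evalAt M f = r * evalAt N f)
    (hQ : ∀ f ∈ Q, evalAt M f = s * evalAt N f) :
    ∀ f ∈ P * Q, evalAt M f = r * s * evalAt N f := by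
  intro f hf
  refine Submodule.mul_induction_on hf (fun p hp q hq => ?_) fun p q hp hq => ?_
  · rw [map_mul, map_mul, hP p hp, hQ q hq]
    ring
  · rw [map_add, map_add, hp, hq, mul_add]

theorem evalAt_pow_of_scaling {ι : Type*} {n : ℕ} {P : Submodule ℂ (MvPolynomial (ι × Fin n) ℂ)}
    {M N : Matrix ι (Fin n) ℂ} {r : ℂ} (hP : ∀ f ∈ P, evalAt M f = r * evalAt N f) (a : ℕ) :
    ∀ f ∈ P ^ a, evalAt M f = r ^ a * evalAt N f := by
  induction a with
  | zero =>
    intro f hf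
    rw [pow_zero, Submodule.mem_one] at hf
    obtain ⟨z, rfl⟩ := hf
    simp
  | succ a ih =>
    rw [pow_succ, pow_succ]
    exact evalAt_mul_of_scaling ih hP

theorem evalAt_span_of_scaling {ι κ : Type*} {n : ℕ} {v : κ → MvPolynomial (ι × Fin n) ℂ}
    {M N : Matrix ι (Fin n) ℂ} {r : ℂ} (h : ∀ j, evalAt M (v j) = r * evalAt N (v j)) :
    ∀ f ∈ Submodule.span ℂ (Set.range v), evalAt M f = r * evalAt N f := by
  intro f hf
  induction hf using Submodule.span_induction with
  | mem f hf =>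
    obtain ⟨j, rfl⟩ := hf
    exact h j
  | zero => simp
  | add p q _ _ hp hq => rw [map_add, map_add, hp, hq, mul_add]
  | smul z p _ hp =>
    rw [map_smul, map_smul, hp, smul_eq_mul, smul_eq_mul]
    ring

/-- Elements of `multidegree` see a pair of matrices only through the vectors $x,h,y,k$, and they
are homogeneous in each of these. -/
theorem evalAt_eq_of_scaling {a b c d : ℕ} {f : MvPolynomial ((Fin 4 ⊕ Fin 4) × Fin 4) ℂ}
    (hf : f ∈ multidegree a b c d) {M N : Matrix (Fin 4 ⊕ Fin 4) (Fin 4) ℂ} {α β γ δ : ℂ}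
    (hα : ∀ j, evalAt M (rowVec Sum.inl j) = α * evalAt N (rowVec Sum.inl j))
    (hβ : ∀ j, evalAt M (coVec Sum.inl j) = β * evalAt N (coVec Sum.inl j))
    (hγ : ∀ j, evalAt M (rowVec Sum.inr j) = γ * evalAt N (rowVec Sum.inr j))
    (hδ : ∀ j, evalAt M (coVec Sum.inr j) = δ * evalAt N (coVec Sum.inr j)) :
    evalAt M f = α ^ a * β ^ b * (γ ^ c * δ ^ d) * evalAt N f :=
  evalAt_mul_of_scaling
    (evalAt_mul_of_scaling (evalAt_pow_of_scaling (evalAt_span_of_scaling hα) a)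
      (evalAt_pow_of_scaling (evalAt_span_of_scaling hβ) b))
    (evalAt_mul_of_scaling (evalAt_pow_of_scaling (evalAt_span_of_scaling hγ) c)
      (evalAt_pow_of_scaling (evalAt_span_of_scaling hδ) d)) f hf

/-- A generic pair of flags `(x, h)`, `(y, k)` is moved to a standard one by an upper triangular
matrix. -/
theorem exists_upper_normalization {x h y k : Fin 4 → ℂ} {p₅ p₆ p₇ p₈ : ℂ}
    (hxh : x 0 * h 0 + x 1 * h 1 + x 2 * h 2 + x 3 * h 3 = 0)
    (hyk : y 0 * k 0 + y 1 * k 1 + y 2 * k 2 + y 3 * k 3 = 0)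
    (h₅ : p₅ = x 0 * y 1 - x 1 * y 0)
    (h₆ : p₆ = x 0 * k 0 + x 1 * k 1 + x 2 * k 2 + x 3 * k 3)
    (h₇ : p₇ = y 0 * h 0 + y 1 * h 1 + y 2 * h 2 + y 3 * h 3)
    (h₈ : p₈ = h 2 * k 3 - h 3 * k 2) (hx : x 0 ≠ 0) (hy : y 0 ≠ 0) (hh : h 3 ≠ 0)
    (n₅ : p₅ ≠ 0) (n₆ : p₆ ≠ 0) (n₇ : p₇ ≠ 0) (n₈ : p₈ ≠ 0) :
    ∃ b c : Matrix (Fin 4) (Fin 4) ℂ, b.BlockTriangular id ∧ b * c = 1 ∧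
      b 0 0 = 1 / y 0 ∧ b 1 1 = x 0 / p₅ ∧ b 2 2 = x 0 * p₈ / (y 0 * h 3 * p₆) ∧
      b 3 3 = h 3 / p₇ ∧
      b.vecMul x = ![x 0 / y 0, 0, 0, 0] ∧
      c.mulVec h = ![0, 0, 0, p₇] ∧
      b.vecMul y = ![1, 1, 0, 1] ∧
      c.mulVec k = (y 0 * p₆ / x 0) • ![1, -(1 + x 0 * k 3 * p₇ / (y 0 * h 3 * p₆)), -1,
        x 0 * k 3 * p₇ / (y 0 * h 3 * p₆)] := by
  -- The columns of `b` are forced by the targets. Column 1 is proportional to $(-x_1,x_0,0,0)$, and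
  -- the last one is $h/p_7$ with $p_7$ = `p₇`, so both are annihilated by $x$ and pair to $1$ with
  -- $y$. In column 2, `s` makes both $x$ and $y$ vanish, and `t` is the remaining scale, chosen so
  -- that entry 2 of `c.mulVec k` is minus entry 0.
  obtain ⟨s, hs⟩ : ∃ s, s = -(x 0 * y 2 - x 2 * y 0) / p₅ := ⟨_, rfl⟩
  have hs' : s * p₅ = -(x 0 * y 2 - x 2 * y 0) := by rw [hs]; field_simp
  obtain ⟨t, ht⟩ : ∃ t, t = x 0 * p₈ / (y 0 * h 3 * p₆) := ⟨_, rfl⟩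
  have ht0 : t ≠ 0 := by rw [ht]; positivity
  have ht' : p₈ * x 0 = t * (y 0 * h 3 * p₆) := by rw [ht]; field_simp
  set b : Matrix (Fin 4) (Fin 4) ℂ := !![1 / y 0, -x 1 / p₅, -t * (x 2 + s * x 1) / x 0, h 0 / p₇;
      0, x 0 / p₅, t * s, h 1 / p₇; 0, 0, t, h 2 / p₇; 0, 0, 0, h 3 / p₇] with hb
  set c : Matrix (Fin 4) (Fin 4) ℂ := !![y 0, y 0 * x 1 / x 0, y 0 * x 2 / x 0, y 0 * x 3 / x 0;
      0, p₅ / x 0, -s * p₅ / x 0, p₅ / x 0 * (s * h 2 - h 1) / h 3;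
      0, 0, 1 / t, -h 2 / (h 3 * t); 0, 0, 0, p₇ / h 3] with hc
  have hbc : b * c = 1 := by
    ext i j
    fin_cases i <;> fin_cases j <;> simp [hb, hc, Matrix.mul_apply, Fin.sum_univ_four] <;>
      field_simp
    all_goals first | ring1 | linear_combination hxh
  have hby : b.vecMul y = ![1, 1, 0, 1] := by
    ext j
    fin_cases j <;> simp [hb, Matrix.vecMul, dotProduct, Fin.sum_univ_four] <;> field_simp
    · linear_combination -h₅
    · linear_combination t * hs' - t * s * h₅
    · linear_combination -h₇
  -- The pairing is invariant and $\langle y,k\rangle=0$, so entry 1 of `c.mulVec k` follows from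
  -- the other three.
  have hck : y ⬝ᵥ k = (b.vecMul y) ⬝ᵥ (c.mulVec k) := by
    rw [← Matrix.dotProduct_mulVec, Matrix.mulVec_mulVec, hbc, Matrix.one_mulVec]
  have ck0 : (c.mulVec k) 0 = y 0 * p₆ / x 0 := by
    simp [hc, Matrix.mulVec, dotProduct, Fin.sum_univ_four]
    field_simp
    linear_combination -h₆
  have ck2 : (c.mulVec k) 2 = -(y 0 * p₆ / x 0) := by
    simp [hc, Matrix.mulVec, dotProduct, Fin.sum_univ_four]
    field_simp
    linear_combination x 0 * h₈ - ht'
  have ck3 : (c.mulVec k) 3 = p₇ * k 3 / h 3 := by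
    simp [hc, Matrix.mulVec, dotProduct, Fin.sum_univ_four]
    field_simp
  refine ⟨b, c, ?_, hbc, rfl, rfl, ht, rfl, ?_, ?_, hby, ?_⟩
  · intro i j hij
    fin_cases i <;> fin_cases j <;> simp [hb] at hij ⊢
  · ext j
    fin_cases j <;> simp [hb, Matrix.vecMul, dotProduct, Fin.sum_univ_four] <;> field_simp
    · ring
    · ring
    · linear_combination hxh
  · ext j
    fin_cases j <;> simp [hc, Matrix.mulVec, dotProduct, Fin.sum_univ_four] <;> field_simp
    · linear_combination y 0 * hxh
    · ring
    · ring
  · rw [hby] at hck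
    simp only [dotProduct, Fin.sum_univ_four] at hck
    ext j
    fin_cases j
    · simpa using ck0
    · have hsum : (c.mulVec k) 1 = -(y 0 * p₆ / x 0) - p₇ * k 3 / h 3 := by
        rw [← ck0, ← ck3]
        simp at hck
        linear_combination hyk - hck
      simp [hsum]
      field_simp
      ring
    · simpa using ck2
    · simp [ck3]
      field_simp

/-- Stacking two `4 × 4` matrices whose last rows vanish. -/
def stack {R : Type*} [Zero R] (r s : Matrix (Fin 3) (Fin 4) R) :
    Matrix (Fin 4 ⊕ Fin 4) (Fin 4) R :=
  Matrix.of fun i j => Sum.elim (fun i => Fin.snoc (α := fun _ => R) (fun i => r i j) 0 i)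
    (fun i => Fin.snoc (α := fun _ => R) (fun i => s i j) 0 i) i

theorem evalAt_rowVec_inl_stack (r s : Matrix (Fin 3) (Fin 4) ℂ) (j : Fin 4) :
    evalAt (stack r s) (rowVec Sum.inl j) = r 0 j := by
  rw [evalAt_rowVec]
  rfl

theorem evalAt_rowVec_inr_stack (r s : Matrix (Fin 3) (Fin 4) ℂ) (j : Fin 4) :
    evalAt (stack r s) (rowVec Sum.inr j) = s 0 j := by
  rw [evalAt_rowVec]
  rfl

/-- The signed maximal minors of a `3 × 4` matrix. -/
def minors {R : Type*} [CommRing R] (r : Matrix (Fin 3) (Fin 4) R) : Fin 4 → R :=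
  ![-(r 0 1 * r 1 2 * r 2 3 - r 0 1 * r 1 3 * r 2 2 - r 0 2 * r 1 1 * r 2 3
        + r 0 2 * r 1 3 * r 2 1 + r 0 3 * r 1 1 * r 2 2 - r 0 3 * r 1 2 * r 2 1),
    r 0 0 * r 1 2 * r 2 3 - r 0 0 * r 1 3 * r 2 2 - r 0 2 * r 1 0 * r 2 3
        + r 0 2 * r 1 3 * r 2 0 + r 0 3 * r 1 0 * r 2 2 - r 0 3 * r 1 2 * r 2 0,
    -(r 0 0 * r 1 1 * r 2 3 - r 0 0 * r 1 3 * r 2 1 - r 0 1 * r 1 0 * r 2 3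
        + r 0 1 * r 1 3 * r 2 0 + r 0 3 * r 1 0 * r 2 1 - r 0 3 * r 1 1 * r 2 0),
    r 0 0 * r 1 1 * r 2 2 - r 0 0 * r 1 2 * r 2 1 - r 0 1 * r 1 0 * r 2 2
        + r 0 1 * r 1 2 * r 2 0 + r 0 2 * r 1 0 * r 2 1 - r 0 2 * r 1 1 * r 2 0]

theorem adjugate_apply_three (M : Matrix (Fin 4) (Fin 4) ℂ) (j : Fin 4) :
    M.adjugate j 3 = minors (M.submatrix Fin.castSucc id) j := by
  rw [Matrix.adjugate_fin_succ_eq_det_submatrix, Matrix.det_fin_three]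
  fin_cases j <;> simp [minors, Fin.succAbove] <;> norm_num

theorem evalAt_coVec_inl_stack (r s : Matrix (Fin 3) (Fin 4) ℂ) (j : Fin 4) :
    evalAt (stack r s) (coVec Sum.inl j) = minors r j := by
  rw [evalAt_coVec, adjugate_apply_three]
  congr 1
  ext i j
  fin_cases i <;> rfl

theorem evalAt_coVec_inr_stack (r s : Matrix (Fin 3) (Fin 4) ℂ) (j : Fin 4) :
    evalAt (stack r s) (coVec Sum.inr j) = minors s j := by
  rw [evalAt_coVec, adjugate_apply_three]
  congr 1
  ext i j
  fin_cases i <;> rfl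

/-- The standard slice. -/
def slicePoint (z : ℂ) : Matrix (Fin 4 ⊕ Fin 4) (Fin 4) ℂ :=
  stack !![1, 0, 0, 0; 0, 1, 0, 0; 0, 0, 1, 0] !![1, 1, 0, 1; 1, 0, 1, 0; z, 0, 0, -1]

theorem minors_slicePoint (z : ℂ) :
    minors !![1, 1, 0, 1; 1, 0, 1, 0; z, 0, 0, -1] = ![1, -(1 + z), -1, z] := by
  ext j
  fin_cases j <;> simp [minors]
  ring

/-- The value of a highest weight vector at a generic point is determined by its values on the
slice. -/
theorem IsHighestWeight.evalAt_eq_slice {a b c d : ℕ} {n : Fin 4 → ℕ}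
    {f : MvPolynomial ((Fin 4 ⊕ Fin 4) × Fin 4) ℂ} (hf : f ∈ multidegree a b c d)
    (hw : IsHighestWeight (ofColumns n) f) {M : Matrix (Fin 4 ⊕ Fin 4) (Fin 4) ℂ} {p : Fin 8 → ℂ}
    (hp : ∀ i, evalAt M (covariant i) = p i) (hp0 : ∀ i, p i ≠ 0) :
    (1 / p 1) ^ n 0 * (p 0 / (p 1 * p 4)) ^ n 1 *
        (p 0 ^ 2 * p 7 / (p 1 ^ 2 * p 2 * p 4 * p 5)) ^ n 2 *
        (p 0 ^ 2 * p 7 / (p 1 ^ 2 * p 4 * p 5 * p 6)) ^ n 3 * evalAt M f =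
      (p 0 / p 1) ^ a * (p 0 ^ 2 * p 7 / (p 1 ^ 2 * p 4 * p 5)) ^ b *
        (p 0 * p 7 / (p 1 * p 4 * p 6)) ^ d *
        evalAt (slicePoint (p 0 * p 3 * p 6 / (p 1 * p 2 * p 5))) f := by
  set x : Fin 4 → ℂ := fun j => evalAt M (rowVec Sum.inl j) with hx
  set y : Fin 4 → ℂ := fun j => evalAt M (rowVec Sum.inr j) with hy
  set h : Fin 4 → ℂ := fun j => evalAt M (coVec Sum.inl j) with hh
  set k : Fin 4 → ℂ := fun j => evalAt M (coVec Sum.inr j) with hk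
  have hortho : ∀ e : Fin 4 → Fin 4 ⊕ Fin 4,
      ∑ j, evalAt M (rowVec e j) * evalAt M (coVec e j) = 0 := by
    intro e
    simp only [evalAt_rowVec, evalAt_coVec]
    have : (M.submatrix e id * (M.submatrix e id).adjugate) 0 3 = 0 := by
      rw [Matrix.mul_adjugate, Matrix.smul_apply, Matrix.one_apply_ne (by decide), smul_zero]
    exact this
  have hxh : x 0 * h 0 + x 1 * h 1 + x 2 * h 2 + x 3 * h 3 = 0 := by
    rw [← hortho Sum.inl, Fin.sum_univ_four]
  have hyk : y 0 * k 0 + y 1 * k 1 + y 2 * k 2 + y 3 * k 3 = 0 := by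
    rw [← hortho Sum.inr, Fin.sum_univ_four]
  have p0 : x 0 = p 0 := hp 0
  have p1 : y 0 = p 1 := hp 1
  have p2 : h 3 = p 2 := hp 2
  have p3 : k 3 = p 3 := hp 3
  have p4 : p 4 = x 0 * y 1 - x 1 * y 0 := by
    rw [← hp 4]
    simp [covariant, hx, hy]
  have p5 : p 5 = x 0 * k 0 + x 1 * k 1 + x 2 * k 2 + x 3 * k 3 := by
    rw [← hp 5]
    simp [covariant, Fin.sum_univ_four, hx, hk]
  have p6 : p 6 = y 0 * h 0 + y 1 * h 1 + y 2 * h 2 + y 3 * h 3 := by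
    rw [← hp 6]
    simp [covariant, Fin.sum_univ_four, hy, hh]
  have p7 : p 7 = h 2 * k 3 - h 3 * k 2 := by
    rw [← hp 7]
    simp [covariant, hh, hk]
  obtain ⟨g, c, hg, hgc, g0, g1, g2, g3, hgx, hch, hgy, hck⟩ :=
    exists_upper_normalization (x := x) (h := h) (y := y) (k := k) hxh hyk p4 p5 p6 p7 (by rw [p0]; exact hp0 0)
      (by rw [p1]; exact hp0 1) (by rw [p2]; exact hp0 2) (hp0 4) (hp0 5) (hp0 6) (hp0 7)
  simp only [p0, p1, p2, p3] at g0 g1 g2 g3 hgx hck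
  have n0 := hp0 0
  have n1 := hp0 1
  have n2 := hp0 2
  have n3 := hp0 3
  have n4 := hp0 4
  have n5 := hp0 5
  have n6 := hp0 6
  have n7 := hp0 7
  have hdet : g.det = p 0 ^ 2 * p 7 / (p 1 ^ 2 * p 4 * p 5 * p 6) := by
    rw [Matrix.det_of_isUpperTriangular hg, Fin.prod_univ_four, g0, g1, g2, g3]
    field_simp
  -- Covectors are transformed by the adjugate, which is the inverse `c` up to the determinant; this
  -- is the source of `g.det` in the scaling factors of $h$ and $k$.
  have hadj : g.adjugate = g.det • c := by
    have : g.adjugate * (g * c) = g.det • c := by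
      rw [← Matrix.mul_assoc, Matrix.adjugate_mul, Matrix.smul_mul, Matrix.one_mul]
    rw [← this, hgc, Matrix.mul_one]
  have hrow : ∀ e j, evalAt (M * g) (rowVec e j) =
      g.vecMul (fun j => evalAt M (rowVec e j)) j := by
    intro e j
    simp only [evalAt_rowVec]
    rfl
  have hco : ∀ e j, evalAt (M * g) (coVec e j) =
      g.det * c.mulVec (fun j => evalAt M (coVec e j)) j := by
    intro e j
    rw [← evalAt_act, act_coVec, hadj, map_sum, Matrix.mulVec, dotProduct, Finset.mul_sum]
    simp only [map_smul, Matrix.smul_apply, smul_eq_mul, mul_assoc]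
  have hMg := evalAt_act M g f
  rw [hw g hg (by rw [hdet]; positivity), map_smul, smul_eq_mul,
    evalAt_highestWeightVector_ofColumns _ hg, g0, g1, g2, g3] at hMg
  have hscale := evalAt_eq_of_scaling hf (M := M * g)
    (N := slicePoint (p 0 * p 3 * p 6 / (p 1 * p 2 * p 5))) (α := p 0 / p 1) (β := g.det * p 6)
    (γ := 1) (δ := g.det * (p 1 * p 5 / p 0)) ?_ ?_ ?_ ?_
  · rw [← hMg, hdet] at hscale
    have e1 : 1 / p 1 * (p 0 / p 4) = p 0 / (p 1 * p 4) := by field_simp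
    have e2 : p 0 / (p 1 * p 4) * (p 0 * p 7 / (p 1 * p 2 * p 5)) =
        p 0 ^ 2 * p 7 / (p 1 ^ 2 * p 2 * p 4 * p 5) := by field_simp
    have e3 : p 0 ^ 2 * p 7 / (p 1 ^ 2 * p 2 * p 4 * p 5) * (p 2 / p 6) =
        p 0 ^ 2 * p 7 / (p 1 ^ 2 * p 4 * p 5 * p 6) := by field_simp
    have e4 : p 0 ^ 2 * p 7 / (p 1 ^ 2 * p 4 * p 5 * p 6) * p 6 =
        p 0 ^ 2 * p 7 / (p 1 ^ 2 * p 4 * p 5) := by field_simp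
    have e5 : p 0 ^ 2 * p 7 / (p 1 ^ 2 * p 4 * p 5 * p 6) * (p 1 * p 5 / p 0) =
        p 0 * p 7 / (p 1 * p 4 * p 6) := by field_simp
    rw [e1, e2, e3, e4, e5, one_pow, one_mul] at hscale
    exact hscale
  · intro j
    rw [hrow, slicePoint, evalAt_rowVec_inl_stack]
    refine (congrFun hgx j).trans ?_
    fin_cases j <;> simp
  · intro j
    rw [hco, slicePoint, evalAt_coVec_inl_stack]
    refine (congrArg (g.det * ·) (congrFun hch j)).trans ?_
    fin_cases j <;> simp [minors]
  · intro j
    rw [hrow, slicePoint, evalAt_rowVec_inr_stack]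
    refine (congrFun hgy j).trans ?_
    fin_cases j <;> simp
  · intro j
    rw [hco, slicePoint, evalAt_coVec_inr_stack]
    refine (congrArg (g.det * ·) (congrFun hck j)).trans ?_
    rw [minors_slicePoint, Pi.smul_apply, smul_eq_mul]
    exact (mul_assoc _ _ _).symm

end Slice
end LRCone

namespace LRCone

open MvPolynomial TensorProduct

/-! ### Orders along the divisors of the covariants -/

section Orders

theorem evalAt_stack_covariant (r s : Matrix (Fin 3) (Fin 4) ℂ) (i : Fin 8) :
    evalAt (stack r s) (covariant i) = ![r 0 0, s 0 0, minors r 3, minors s 3,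
      r 0 0 * s 0 1 - r 0 1 * s 0 0,
      r 0 0 * minors s 0 + r 0 1 * minors s 1 + r 0 2 * minors s 2 + r 0 3 * minors s 3,
      s 0 0 * minors r 0 + s 0 1 * minors r 1 + s 0 2 * minors r 2 + s 0 3 * minors r 3,
      minors r 2 * minors s 3 - minors r 3 * minors s 2] i := by
  fin_cases i <;>
    simp [covariant, evalAt_rowVec_inl_stack, evalAt_rowVec_inr_stack, evalAt_coVec_inl_stack,
      evalAt_coVec_inr_stack, Fin.sum_univ_four]

theorem stack_map {R S : Type*} [Zero R] [Zero S] (f : R → S) (hf : f 0 = 0)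
    (r s : Matrix (Fin 3) (Fin 4) R) : (stack r s).map f = stack (r.map f) (s.map f) := by
  ext i j
  rcases i with i | i <;> induction i using Fin.lastCases with
  | last =>
    simp only [stack, Matrix.map_apply, Matrix.of_apply, Sum.elim_inl, Sum.elim_inr, Fin.snoc_last,
      hf]
  | cast i => simp [stack]

/-- This family and the next two prescribe some covariants freely and keep the others equal to $1$.
Together they let each of the eight covariants be the one that vanishes. -/
theorem covariant_curve_one (p₁ p₃ p₆ p₇ : ℂ) (i : Fin 8) :
    evalAt (stack !![1, 0, 0, 0; 0, 1, 0, 0; 0, 0, 1, 0] !![p₁, 1, 0, p₆; p₇, 0, 1, 0; p₃, 0, 0, -1])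
      (covariant i) = ![1, p₁, 1, p₃, 1, 1, p₆, p₇] i := by
  rw [evalAt_stack_covariant]
  fin_cases i <;> simp [minors]

theorem covariant_curve_two (p₃ p₅ : ℂ) (i : Fin 8) :
    evalAt (stack !![1, 0, 0, 0; 0, 1, 0, 0; 0, 0, 1, 0] !![1, 1, 0, 1; 1, 0, p₅, 0; 0, 0, -p₃, -1])
      (covariant i) = ![1, 1, 1, p₃, 1, p₅, 1, 1] i := by
  rw [evalAt_stack_covariant]
  fin_cases i <;> simp [minors]

theorem covariant_curve_three (p₀ p₂ p₄ : ℂ) (i : Fin 8) :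
    evalAt (stack !![p₀, -p₄, -(p₀ + p₂), 1; 0, 1, 0, 0; 1, 0, -1, 0]
      !![1, 0, 0, 0; 0, 1, 0, 0; 0, 0, 1, 0])
      (covariant i) = ![p₀, 1, p₂, 1, p₄, 1, 1, 1] i := by
  rw [evalAt_stack_covariant]
  fin_cases i <;> simp [minors]

/-- There are polynomial curves of pairs of matrices along which one of the covariants vanishes to
first order and the others are constant. -/
theorem exists_curve (i : Fin 8) {z : ℂ} (hz : z ≠ 0) :
    ∃ (M : Matrix (Fin 4 ⊕ Fin 4) (Fin 4) (Polynomial ℂ)) (q : Fin 8 → ℂ), (∀ j, q j ≠ 0) ∧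
      q 0 * q 3 * q 6 / (q 1 * q 2 * q 5) = z ∧
      ∀ s j, evalAt (M.map (Polynomial.eval s)) (covariant j) =
        q j * s ^ ((Pi.single i 1 : Fin 8 → ℤ) j) := by
  have h₁ : ∀ (r₁ r₃ r₆ r₇ : Polynomial ℂ) (s : ℂ) (j : Fin 8),
      evalAt ((stack !![1, 0, 0, 0; 0, 1, 0, 0; 0, 0, 1, 0]
        !![r₁, 1, 0, r₆; r₇, 0, 1, 0; r₃, 0, 0, -1]).map (Polynomial.eval s)) (covariant j) =
      ![1, r₁.eval s, 1, r₃.eval s, 1, 1, r₆.eval s, r₇.eval s] j := by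
    intro r₁ r₃ r₆ r₇ s j
    rw [stack_map _ Polynomial.eval_zero, ← covariant_curve_one]
    refine congrArg₂ (fun A B => evalAt (stack A B) (covariant j)) ?_ ?_ <;>
      ext i k <;> fin_cases i <;> fin_cases k <;> simp
  have h₂ : ∀ (r₃ r₅ : Polynomial ℂ) (s : ℂ) (j : Fin 8),
      evalAt ((stack !![1, 0, 0, 0; 0, 1, 0, 0; 0, 0, 1, 0]
        !![1, 1, 0, 1; 1, 0, r₅, 0; 0, 0, -r₃, -1]).map (Polynomial.eval s)) (covariant j) =
      ![1, 1, 1, r₃.eval s, 1, r₅.eval s, 1, 1] j := by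
    intro r₃ r₅ s j
    rw [stack_map _ Polynomial.eval_zero, ← covariant_curve_two]
    refine congrArg₂ (fun A B => evalAt (stack A B) (covariant j)) ?_ ?_ <;>
      ext i k <;> fin_cases i <;> fin_cases k <;> simp
  have h₃ : ∀ (r₀ r₂ r₄ : Polynomial ℂ) (s : ℂ) (j : Fin 8),
      evalAt ((stack !![r₀, -r₄, -(r₀ + r₂), 1; 0, 1, 0, 0; 1, 0, -1, 0]
        !![1, 0, 0, 0; 0, 1, 0, 0; 0, 0, 1, 0]).map (Polynomial.eval s)) (covariant j) =
      ![r₀.eval s, 1, r₂.eval s, 1, r₄.eval s, 1, 1, 1] j := by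
    intro r₀ r₂ r₄ s j
    rw [stack_map _ Polynomial.eval_zero, ← covariant_curve_three]
    refine congrArg₂ (fun A B => evalAt (stack A B) (covariant j)) ?_ ?_ <;>
      ext i k <;> fin_cases i <;> fin_cases k <;> simp
  have hq₃ : ∀ j, (![1, 1, 1, z, 1, 1, 1, 1] : Fin 8 → ℂ) j ≠ 0 := by
    intro j
    fin_cases j <;> simp [hz]
  have hq₀ : ∀ j, (![z, 1, 1, 1, 1, 1, 1, 1] : Fin 8 → ℂ) j ≠ 0 := by
    intro j
    fin_cases j <;> simp [hz]
  fin_cases i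
  · refine ⟨_, _, hq₀, by simp, fun s j => (h₃ (Polynomial.C z * Polynomial.X) 1 1 s j).trans ?_⟩
    fin_cases j <;> simp
  · refine ⟨_, _, hq₃, by simp, fun s j => (h₁ Polynomial.X (Polynomial.C z) 1 1 s j).trans ?_⟩
    fin_cases j <;> simp
  · refine ⟨_, _, hq₀, by simp, fun s j => (h₃ (Polynomial.C z) Polynomial.X 1 s j).trans ?_⟩
    fin_cases j <;> simp
  · refine ⟨_, _, hq₃, by simp, fun s j =>
      (h₁ 1 (Polynomial.C z * Polynomial.X) 1 1 s j).trans ?_⟩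
    fin_cases j <;> simp
  · refine ⟨_, _, hq₀, by simp, fun s j => (h₃ (Polynomial.C z) 1 Polynomial.X s j).trans ?_⟩
    fin_cases j <;> simp
  · refine ⟨_, _, hq₃, by simp, fun s j => (h₂ (Polynomial.C z) Polynomial.X s j).trans ?_⟩
    fin_cases j <;> simp
  · refine ⟨_, _, hq₃, by simp, fun s j => (h₁ 1 (Polynomial.C z) Polynomial.X 1 s j).trans ?_⟩
    fin_cases j <;> simp
  · refine ⟨_, _, hq₃, by simp, fun s j => (h₁ 1 (Polynomial.C z) 1 Polynomial.X s j).trans ?_⟩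
    fin_cases j <;> simp

/-- The orders of vanishing on the slice of highest weight vectors along the divisors of the
covariants. -/
def order (a b d : ℕ) (n : Fin 4 → ℕ) : Fin 8 → ℤ :=
  ![a + 2 * b + d - n 1 - 2 * n 2 - 2 * n 3, n 0 + n 1 + 2 * n 2 + 2 * n 3 - a - 2 * b - d, n 2, 0,
    n 1 + n 2 + n 3 - b - d, n 2 + n 3 - b, n 3 - d, b + d - n 2 - n 3]

/-- The exponents of the slice coordinate. -/
def slope : Fin 8 → ℤ := ![1, -1, -1, 1, 0, -1, 1, 0]

variable {a b c d : ℕ} {n : Fin 4 → ℕ} {f : MvPolynomial ((Fin 4 ⊕ Fin 4) × Fin 4) ℂ}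

/-- If each covariant equals $q_is^{e_i}$, the powers of $s$ in the slice formula collect into
`order`, and those in the slice coordinate into `slope`. The constant depends neither on $s$ nor on
the point. -/
theorem IsHighestWeight.exists_evalAt_eq (hf : f ∈ multidegree a b c d)
    (hw : IsHighestWeight (ofColumns n) f) {q : Fin 8 → ℂ} (hq : ∀ i, q i ≠ 0) (e : Fin 8 → ℤ) :
    ∃ C : ℂ, C ≠ 0 ∧ ∀ (s : ℂ) (M : Matrix (Fin 4 ⊕ Fin 4) (Fin 4) ℂ), s ≠ 0 →
      (∀ i, evalAt M (covariant i) = q i * s ^ e i) →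
      evalAt M f = C * s ^ (∑ i, e i * order a b d n i) *
        evalAt (slicePoint (q 0 * q 3 * q 6 / (q 1 * q 2 * q 5) * s ^ (∑ i, e i * slope i))) f := by
  have n0 := hq 0
  have n1 := hq 1
  have n2 := hq 2
  have n4 := hq 4
  have n5 := hq 5
  have n6 := hq 6
  have n7 := hq 7
  refine ⟨((q 0 / q 1) ^ a * (q 0 ^ 2 * q 7 / (q 1 ^ 2 * q 4 * q 5)) ^ b *
        (q 0 * q 7 / (q 1 * q 4 * q 6)) ^ d) / ((1 / q 1) ^ n 0 * (q 0 / (q 1 * q 4)) ^ n 1 *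
        (q 0 ^ 2 * q 7 / (q 1 ^ 2 * q 2 * q 4 * q 5)) ^ n 2 *
        (q 0 ^ 2 * q 7 / (q 1 ^ 2 * q 4 * q 5 * q 6)) ^ n 3), by simp [n0, n1, n2, n4, n5, n6, n7],
    fun s M hs hM => ?_⟩
  have key := hw.evalAt_eq_slice hf hM fun i => mul_ne_zero (hq i) (zpow_ne_zero _ hs)
  have hz := fun k => zpow_ne_zero k hs
  have e0 : 1 / (q 1 * s ^ e 1) = 1 / q 1 * s ^ (-e 1) := by
    rw [zpow_neg]
    field_simp
  have e1 : q 0 * s ^ e 0 / (q 1 * s ^ e 1 * (q 4 * s ^ e 4)) =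
      q 0 / (q 1 * q 4) * s ^ (e 0 - e 1 - e 4) := by
    simp only [zpow_sub₀ hs]
    field_simp
  have e2 : (q 0 * s ^ e 0) ^ 2 * (q 7 * s ^ e 7) /
        ((q 1 * s ^ e 1) ^ 2 * (q 2 * s ^ e 2) * (q 4 * s ^ e 4) * (q 5 * s ^ e 5)) =
      q 0 ^ 2 * q 7 / (q 1 ^ 2 * q 2 * q 4 * q 5) *
        s ^ (e 0 + e 0 + e 7 - e 1 - e 1 - e 2 - e 4 - e 5) := by
    simp only [zpow_sub₀ hs, zpow_add₀ hs]
    field_simp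
  have e3 : (q 0 * s ^ e 0) ^ 2 * (q 7 * s ^ e 7) /
        ((q 1 * s ^ e 1) ^ 2 * (q 4 * s ^ e 4) * (q 5 * s ^ e 5) * (q 6 * s ^ e 6)) =
      q 0 ^ 2 * q 7 / (q 1 ^ 2 * q 4 * q 5 * q 6) *
        s ^ (e 0 + e 0 + e 7 - e 1 - e 1 - e 4 - e 5 - e 6) := by
    simp only [zpow_sub₀ hs, zpow_add₀ hs]
    field_simp
  have e4 : q 0 * s ^ e 0 / (q 1 * s ^ e 1) = q 0 / q 1 * s ^ (e 0 - e 1) := by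
    simp only [zpow_sub₀ hs]
    field_simp
  have e5 : (q 0 * s ^ e 0) ^ 2 * (q 7 * s ^ e 7) /
        ((q 1 * s ^ e 1) ^ 2 * (q 4 * s ^ e 4) * (q 5 * s ^ e 5)) =
      q 0 ^ 2 * q 7 / (q 1 ^ 2 * q 4 * q 5) * s ^ (e 0 + e 0 + e 7 - e 1 - e 1 - e 4 - e 5) := by
    simp only [zpow_sub₀ hs, zpow_add₀ hs]
    field_simp
  have e6 : q 0 * s ^ e 0 * (q 7 * s ^ e 7) / (q 1 * s ^ e 1 * (q 4 * s ^ e 4) * (q 6 * s ^ e 6)) =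
      q 0 * q 7 / (q 1 * q 4 * q 6) * s ^ (e 0 + e 7 - e 1 - e 4 - e 6) := by
    simp only [zpow_sub₀ hs, zpow_add₀ hs]
    field_simp
  have e7 : q 0 * s ^ e 0 * (q 3 * s ^ e 3) * (q 6 * s ^ e 6) /
        (q 1 * s ^ e 1 * (q 2 * s ^ e 2) * (q 5 * s ^ e 5)) =
      q 0 * q 3 * q 6 / (q 1 * q 2 * q 5) * s ^ (∑ i, e i * slope i) := by
    have : ∑ i, e i * slope i = e 0 + e 3 + e 6 - e 1 - e 2 - e 5 := by
      rw [Fin.sum_univ_eight]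
      simp [slope]
      ring
    rw [this]
    simp only [zpow_sub₀ hs, zpow_add₀ hs]
    field_simp
  rw [e0, e1, e2, e3, e4, e5, e6, e7] at key
  have hp : ∀ (k : ℤ) (l : ℕ), (s ^ k) ^ l = s ^ (k * l) := fun k l => by
    rw [zpow_mul, zpow_natCast]
  have hE : ∑ i, e i * order a b d n i = (e 0 - e 1) * a +
      (e 0 + e 0 + e 7 - e 1 - e 1 - e 4 - e 5) * b + (e 0 + e 7 - e 1 - e 4 - e 6) * d -
      (-e 1) * n 0 - (e 0 - e 1 - e 4) * n 1 -
      (e 0 + e 0 + e 7 - e 1 - e 1 - e 2 - e 4 - e 5) * n 2 -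
      (e 0 + e 0 + e 7 - e 1 - e 1 - e 4 - e 5 - e 6) * n 3 := by
    rw [Fin.sum_univ_eight]
    simp [order]
    ring
  rw [hE]
  simp only [zpow_sub₀ hs, zpow_add₀ hs]
  generalize evalAt (slicePoint _) f = v at key ⊢
  simp only [mul_pow, hp] at key
  have aux : ∀ {w A₁ A₂ A₃ B₀ B₁ B₂ B₃ S₁ S₂ S₃ T₀ T₁ T₂ T₃ : ℂ}, B₀ ≠ 0 → B₁ ≠ 0 → B₂ ≠ 0 →
      B₃ ≠ 0 → T₀ ≠ 0 → T₁ ≠ 0 → T₂ ≠ 0 → T₃ ≠ 0 →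
      B₀ * T₀ * (B₁ * T₁) * (B₂ * T₂) * (B₃ * T₃) * w = A₁ * S₁ * (A₂ * S₂) * (A₃ * S₃) * v →
      w = A₁ * A₂ * A₃ / (B₀ * B₁ * B₂ * B₃) * (S₁ * S₂ * S₃ / T₀ / T₁ / T₂ / T₃) * v := by
    intro w A₁ A₂ A₃ B₀ B₁ B₂ B₃ S₁ S₂ S₃ T₀ T₁ T₂ T₃ h₁ h₂ h₃ h₄ h₅ h₆ h₇ h₈ h
    field_simp
    linear_combination h
  exact aux (by simp [n1]) (by simp [n0, n1, n4]) (by simp [n0, n1, n2, n4, n5, n7])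
    (by simp [n0, n1, n4, n5, n6, n7]) (hz _) (hz _) (hz _) (hz _) key

end Orders
end LRCone

namespace LRCone

open MvPolynomial TensorProduct

/-! ### Numerical constraints on the weights of highest weight vectors -/

section Constraints

/-- Compare the orders at zero and at infinity of a function on the punctured line. -/
theorem eq_zpow_of_polynomial_continuations {P Q : Polynomial ℂ} {C C' : ℂ} {E E' : ℤ} {h : ℂ → ℂ}
    (hC : C ≠ 0) (hC' : C' ≠ 0) (hP : ∀ s, s ≠ 0 → P.eval s = C * s ^ E * h s)
    (hQ : ∀ s, s ≠ 0 → Q.eval s = C' * s ^ E' * h s⁻¹) (hne : ∃ s, s ≠ 0 ∧ h s ≠ 0)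
    (hE : E + E' ≤ 0) : E + E' = 0 ∧ ∃ r, ∀ s, s ≠ 0 → h s = r * s ^ (-E) := by
  obtain ⟨m, hm⟩ : ∃ m : ℕ, E + E' = -(m : ℤ) := ⟨(-(E + E')).toNat, by lia⟩
  have hP0 : P ≠ 0 := by
    rintro rfl
    obtain ⟨s, hs, hs'⟩ := hne
    have := hP s hs
    simp [hC, hs', zpow_ne_zero, hs] at this
  -- Reversing `Q` substitutes $s^{-1}$ and clears denominators, so both polynomials express the
  -- same function $h$. Since the reverse has degree at most that of `Q`, both `m` and the degree of
  -- `P` must be zero.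
  have key : Q.reverse = Polynomial.C (C' / C) * (Polynomial.X ^ (Q.natDegree + m) * P) := by
    refine Polynomial.eq_of_infinite_eval_eq _ _
      ((Set.finite_singleton (0 : ℂ)).infinite_compl.mono fun s (hs : s ≠ 0) => ?_)
    let _ : Invertible s⁻¹ := invertibleOfNonzero (inv_ne_zero hs)
    have h1 := Polynomial.eval₂_reverse_mul_pow (RingHom.id ℂ) s⁻¹ Q
    rw [invOf_eq_inv, inv_inv] at h1
    change Q.reverse.eval s * s⁻¹ ^ Q.natDegree = Q.eval s⁻¹ at h1
    rw [hQ _ (inv_ne_zero hs), inv_inv] at h1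
    have h2 : Q.reverse.eval s = s ^ Q.natDegree * (C' * s⁻¹ ^ E' * h s) := by
      rw [← h1, inv_pow]
      field_simp
    have h3 : s⁻¹ ^ E' = s ^ m * s ^ E := by
      rw [inv_zpow', ← zpow_natCast, ← zpow_add₀ hs]
      congr 1
      lia
    change Q.reverse.eval s = _
    rw [h2, h3]
    simp only [Polynomial.eval_mul, Polynomial.eval_C, Polynomial.eval_pow, Polynomial.eval_X,
      hP s hs]
    field_simp
    ring
  have hdeg := Polynomial.reverse_natDegree_le Q
  rw [key, Polynomial.natDegree_C_mul (div_ne_zero hC' hC),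
    Polynomial.natDegree_mul (pow_ne_zero _ Polynomial.X_ne_zero) hP0,
    Polynomial.natDegree_X_pow] at hdeg
  refine ⟨by lia, P.coeff 0 / C, fun s hs => ?_⟩
  have h1 := hP s hs
  rw [Polynomial.eq_C_of_natDegree_eq_zero (show P.natDegree = 0 by lia), Polynomial.eval_C] at h1
  have := zpow_ne_zero E hs
  rw [zpow_neg, h1]
  field_simp

variable {a b c d : ℕ} {n : Fin 4 → ℕ} {f g : MvPolynomial ((Fin 4 ⊕ Fin 4) × Fin 4) ℂ}

theorem covariant_ne_zero (i : Fin 8) : covariant i ≠ 0 := by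
  intro h
  have := covariant_curve_three 1 1 1 i
  rw [h, map_zero] at this
  fin_cases i <;> simp at this

/-- Along the curve on which covariant $i$ vanishes to first order, $f$ is a polynomial in $s$,
although the right-hand side could have a pole at $s=0$. -/
theorem IsHighestWeight.exists_polynomial_slice (hf : f ∈ multidegree a b c d)
    (hw : IsHighestWeight (ofColumns n) f) (i : Fin 8) {z : ℂ} (hz : z ≠ 0) :
    ∃ (P : Polynomial ℂ) (C : ℂ), C ≠ 0 ∧ ∀ s, s ≠ 0 → P.eval s =
      C * s ^ order a b d n i * evalAt (slicePoint (z * s ^ slope i)) f := by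
  obtain ⟨M, q, hq, hqz, hM⟩ := exists_curve i hz
  obtain ⟨P, hP⟩ := exists_polynomial_evalAt M f
  obtain ⟨C, hC, h⟩ := hw.exists_evalAt_eq hf hq (Pi.single i 1)
  refine ⟨P, C, hC, fun s hs => ?_⟩
  rw [hP, h s _ hs (hM s), hqz]
  simp [Pi.single_apply]

/-- Such an $f$ vanishes wherever all covariants are nonzero, so its product with all of them is
zero. -/
theorem IsHighestWeight.eq_zero_of_slice (hf : f ∈ multidegree a b c d)
    (hw : IsHighestWeight (ofColumns n) f) (h : ∀ z, z ≠ 0 → evalAt (slicePoint z) f = 0) :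
    f = 0 := by
  have h0 : f * ∏ i, covariant i = 0 := by
    refine eq_of_evalAt fun M => ?_
    rw [map_mul, map_prod, map_zero]
    by_cases hM : ∀ i, evalAt M (covariant i) ≠ 0
    · have key := hw.evalAt_eq_slice hf (fun _ => rfl) hM
      have n0 := hM 0
      have n1 := hM 1
      have n2 := hM 2
      have n3 := hM 3
      have n4 := hM 4
      have n5 := hM 5
      have n6 := hM 6
      have n7 := hM 7
      rw [h _ (by simp [n0, n1, n2, n3, n5, n6]), mul_zero] at key
      rw [(mul_eq_zero.1 key).resolve_left (by simp [n0, n1, n2, n4, n5, n6, n7]), zero_mul]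
    · push Not at hM
      obtain ⟨i, hi⟩ := hM
      rw [Finset.prod_eq_zero (Finset.mem_univ i) hi, mul_zero]
  exact (mul_eq_zero.1 h0).resolve_right (Finset.prod_ne_zero_iff.2 fun i _ => covariant_ne_zero i)

/-- With slope zero the slice coordinate stays constant on the curve, so a nonzero multiple of $s$
to the power `order` is polynomial. -/
theorem IsHighestWeight.order_nonneg (hf : f ∈ multidegree a b c d)
    (hw : IsHighestWeight (ofColumns n) f) (h0 : f ≠ 0) {i : Fin 8} (hi : slope i = 0) :
    0 ≤ order a b d n i := by
  by_contra! hneg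
  obtain ⟨z, hz, hv⟩ : ∃ z, z ≠ 0 ∧ evalAt (slicePoint z) f ≠ 0 := by
    by_contra! hall
    exact h0 (hw.eq_zero_of_slice hf hall)
  obtain ⟨P, C, hC, hP⟩ := hw.exists_polynomial_slice hf i hz
  have := (eq_zpow_of_polynomial_continuations (Q := Polynomial.C (evalAt (slicePoint z) f))
    (E' := 0) (h := fun _ => evalAt (slicePoint z) f) hC one_ne_zero
    (fun s hs => by simpa [hi] using hP s hs) (fun s _ => by simp) ⟨1, one_ne_zero, hv⟩
    (by lia)).1
  lia

/-- The two curves run into the ends $z=0$ and $z=\infty$ of the slice, so `order` at $i$ and $j$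
bounds the pole of the slice function at either end. -/
theorem IsHighestWeight.slice_eq_zpow (hf : f ∈ multidegree a b c d)
    (hw : IsHighestWeight (ofColumns n) f) (h0 : f ≠ 0) {i j : Fin 8} (hi : slope i = 1)
    (hj : slope j = -1) (hij : order a b d n i + order a b d n j ≤ 0) :
    order a b d n i + order a b d n j = 0 ∧ ∃ r, ∀ z, z ≠ 0 →
      evalAt (slicePoint z) f = r * z ^ (-order a b d n i) := by
  obtain ⟨P, C, hC, hP⟩ := hw.exists_polynomial_slice hf i one_ne_zero
  obtain ⟨Q, C', hC', hQ⟩ := hw.exists_polynomial_slice hf j one_ne_zero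
  refine eq_zpow_of_polynomial_continuations (h := fun z => evalAt (slicePoint z) f) hC hC'
    (fun s hs => by simpa [hi] using hP s hs) (fun s hs => by simpa [hj] using hQ s hs) ?_ hij
  by_contra! hall
  exact h0 (hw.eq_zero_of_slice hf hall)

theorem IsHighestWeight.order_add_nonneg (hf : f ∈ multidegree a b c d)
    (hw : IsHighestWeight (ofColumns n) f) (h0 : f ≠ 0) {i j : Fin 8} (hi : slope i = 1)
    (hj : slope j = -1) : 0 ≤ order a b d n i + order a b d n j := by
  by_contra! hneg
  have := (hw.slice_eq_zpow hf h0 hi hj hneg.le).1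
  lia

/-- If two orders add up to zero, then highest weight vectors are unique up to scalars. -/
theorem IsHighestWeight.exists_eq_smul (hf : f ∈ multidegree a b c d)
    (hg : g ∈ multidegree a b c d) (hwf : IsHighestWeight (ofColumns n) f)
    (hwg : IsHighestWeight (ofColumns n) g) (h0 : f ≠ 0) {i j : Fin 8} (hi : slope i = 1)
    (hj : slope j = -1) (hij : order a b d n i + order a b d n j ≤ 0) : ∃ r : ℂ, r • f = g := by
  by_cases hg0 : g = 0
  · exact ⟨0, by rw [hg0, zero_smul]⟩
  obtain ⟨-, r, hr⟩ := hwf.slice_eq_zpow hf h0 hi hj hij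
  obtain ⟨-, t, ht⟩ := hwg.slice_eq_zpow hg hg0 hi hj hij
  have hr0 : r ≠ 0 := by
    rintro rfl
    exact h0 (hwf.eq_zero_of_slice hf fun z hz => by rw [hr z hz, zero_mul])
  have hw : IsHighestWeight (ofColumns n) (t • f - r • g) := fun b hb hdet => by
    rw [map_sub, map_smul, map_smul, hwf b hb hdet, hwg b hb hdet, smul_sub, smul_comm t,
      smul_comm r]
  have h := hw.eq_zero_of_slice (sub_mem (Submodule.smul_mem _ t hf) (Submodule.smul_mem _ r hg))
    fun z hz => by
      rw [map_sub, map_smul, map_smul, hr z hz, ht z hz, smul_eq_mul, smul_eq_mul]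
      ring
  refine ⟨r⁻¹ * t, ?_⟩
  rw [mul_smul, sub_eq_zero.1 h, inv_smul_smul₀ hr0]

/-- The scalar matrix $2$ acts by $2^{|\lambda|+|\mu|}$ by homogeneity, where minors count three
times, and by $2^{|\nu|}$ through its character. -/
theorem IsHighestWeight.size_eq (hf : f ∈ multidegree a b c d)
    (hw : IsHighestWeight (ofColumns n) f) (h0 : f ≠ 0) :
    a + 3 * b + (c + 3 * d) = n 0 + 2 * n 1 + 3 * n 2 + 4 * n 3 := by
  obtain ⟨M, hM⟩ : ∃ M, evalAt M f ≠ 0 := by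
    by_contra! h
    exact h0 (eq_of_evalAt fun M => by rw [h, map_zero])
  have hb : ((2 : ℂ) • (1 : Matrix (Fin 4) (Fin 4) ℂ)).BlockTriangular id :=
    fun i j hij => by simp [Matrix.one_apply_ne (show j < i from hij).ne']
  have h1 := congrArg (evalAt M) (hw _ hb (by simp))
  have hr : ∀ (e : Fin 4 → Fin 4 ⊕ Fin 4) j,
      evalAt ((2 : ℂ) • M) (rowVec e j) = 2 * evalAt M (rowVec e j) := fun e j => by
    rw [evalAt_rowVec, evalAt_rowVec]
    rfl
  have hc : ∀ (e : Fin 4 → Fin 4 ⊕ Fin 4) j,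
      evalAt ((2 : ℂ) • M) (coVec e j) = 2 ^ 3 * evalAt M (coVec e j) := fun e j => by
    have : ((2 : ℂ) • M).submatrix e id = (2 : ℂ) • M.submatrix e id := rfl
    rw [evalAt_coVec, evalAt_coVec, this, Matrix.adjugate_smul]
    simp
  rw [evalAt_act, Matrix.mul_smul, Matrix.mul_one,
    evalAt_eq_of_scaling hf (hr Sum.inl) (hc Sum.inl) (hr Sum.inr) (hc Sum.inr), map_smul,
    evalAt_highestWeightVector_ofColumns n hb, smul_eq_mul] at h1
  have h2 := mul_right_cancel₀ hM h1
  refine Nat.pow_right_injective le_rfl ?_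
  have h3 : ((2 ^ (a + 3 * b + (c + 3 * d)) : ℕ) : ℂ) =
      ((2 ^ (n 0 + 2 * n 1 + 3 * n 2 + 4 * n 3) : ℕ) : ℂ) := by
    push_cast
    simp only [pow_add, pow_mul]
    refine h2.trans ?_
    simp
    norm_num
  exact_mod_cast h3

end Constraints
end LRCone

namespace LRCone

open MvPolynomial TensorProduct

/-! ### The semigroup -/

section Semigroup

variable {a b c d : ℕ} {n : Fin 4 → ℕ} {f : MvPolynomial ((Fin 4 ⊕ Fin 4) × Fin 4) ℂ}

/-- The weights of nonzero highest weight vectors are those of the monomials in the covariants. -/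
theorem IsHighestWeight.exists_exponents (hf : f ∈ multidegree a b c d)
    (hw : IsHighestWeight (ofColumns n) f) (h0 : f ≠ 0) : ∃ m : Fin 8 → ℕ,
      a = m 0 + m 4 + m 5 ∧ b = m 2 + m 6 + m 7 ∧ c = m 1 + m 4 + m 6 ∧ d = m 3 + m 5 + m 7 ∧
        n = columnsOf m := by
  have hs := hw.size_eq hf h0
  have h := fun i j hi hj => hw.order_add_nonneg hf h0 (i := i) (j := j) hi hj
  have h01 := h 0 1 rfl rfl
  have h02 := h 0 2 rfl rfl
  have h05 := h 0 5 rfl rfl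
  have h31 := h 3 1 rfl rfl
  have h32 := h 3 2 rfl rfl
  have h35 := h 3 5 rfl rfl
  have h61 := h 6 1 rfl rfl
  have h62 := h 6 2 rfl rfl
  have h65 := h 6 5 rfl rfl
  have h4 := hw.order_nonneg hf h0 (i := 4) rfl
  have h7 := hw.order_nonneg hf h0 (i := 7) rfl
  simp only [order, Matrix.cons_val] at h01 h02 h05 h31 h32 h35 h61 h62 h65 h4 h7
  clear h
  -- `k` is the exponent of covariant 3, the only freedom left by the relation among the weights:
  -- exponent $i$ is `order` plus `slope` times `k`. Slope $1$ gives lower bounds and slope $-1$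
  -- upper bounds, compatible by the nine pairwise inequalities. The witness is the largest lower
  -- bound; truncated subtraction takes care of the bound $0$ from index 3.
  obtain ⟨k, hk1, hk2, hk3, hk4, hk5⟩ : ∃ k : ℕ, (0 : ℤ) ≤ n 3 - d + k ∧
      (0 : ℤ) ≤ a + 2 * b + d - n 1 - 2 * n 2 - 2 * n 3 + k ∧
      (0 : ℤ) ≤ n 0 + n 1 + 2 * n 2 + 2 * n 3 - a - 2 * b - d - k ∧ (0 : ℤ) ≤ n 2 - k ∧
      (0 : ℤ) ≤ n 2 + n 3 - b - k :=
    ⟨max (d - n 3) (n 1 + 2 * n 2 + 2 * n 3 - (a + 2 * b + d)), by lia, by lia, by lia, by lia,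
      by lia⟩
  refine ⟨![(a + 2 * b + d - n 1 - 2 * n 2 - 2 * n 3 + k : ℤ).toNat,
    (n 0 + n 1 + 2 * n 2 + 2 * n 3 - a - 2 * b - d - k : ℤ).toNat, n 2 - k, k,
    (n 1 + n 2 + n 3 - b - d : ℤ).toNat, (n 2 + n 3 - b - k : ℤ).toNat, (n 3 - d + k : ℤ).toNat,
    (b + d - n 2 - n 3 : ℤ).toNat], ?_, ?_, ?_, ?_, ?_⟩
  any_goals simp only [Matrix.cons_val]
  any_goals lia
  ext i
  fin_cases i <;> simp [columnsOf] <;> lia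

theorem covariantMonomial_ne_zero (m : Fin 8 → ℕ) : covariantMonomial m ≠ 0 :=
  Finset.prod_ne_zero_iff.2 fun i _ => pow_ne_zero _ (covariant_ne_zero i)

/-- The triple of weights of a monomial in the covariants. -/
def weightTriple (m : Fin 8 → ℕ) : Triple 4 :=
  (nearRect (m 0 + m 4 + m 5) (m 2 + m 6 + m 7), nearRect (m 1 + m 4 + m 6) (m 3 + m 5 + m 7),
    ofColumns (columnsOf m))

theorem covariantMonomial_mem_highestWeightSpace (m : Fin 8 → ℕ) : covariantMonomial m ∈
    highestWeightSpace (weightTriple m).1 (weightTriple m).2.1 (weightTriple m).2.2 :=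
  mem_highestWeightSpace_nearRect.2 ⟨covariantMonomial_mem m, isHighestWeight_covariantMonomial m⟩

theorem lrCoeff_weightTriple_ne_zero (m : Fin 8 → ℕ) :
    lrCoeff (weightTriple m).1 (weightTriple m).2.1 (weightTriple m).2.2 ≠ 0 := by
  rw [lrCoeff_eq_finrank]
  have : Nontrivial (highestWeightSpace (weightTriple m).1 (weightTriple m).2.1
      (weightTriple m).2.2) :=
    ⟨⟨_, covariantMonomial_mem_highestWeightSpace m⟩, 0,
      fun h => covariantMonomial_ne_zero m (congrArg Subtype.val h)⟩
  have : FiniteDimensional ℂ (highestWeightSpace (weightTriple m).1 (weightTriple m).2.1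
      (weightTriple m).2.2) := finiteDimensional_highestWeightSpace
  exact Module.finrank_pos.ne'

theorem antitone_nearRect (a b : ℕ) : Antitone (nearRect a b) :=
  Fin.antitone_iff_succ_le.2 fun i => by fin_cases i <;> simp [nearRect]

theorem antitone_ofColumns (n : Fin 4 → ℕ) : Antitone (ofColumns n) :=
  Fin.antitone_iff_succ_le.2 fun i => by fin_cases i <;> simp [ofColumns]

theorem exists_eq_nearRect {lam : Fin 4 → ℕ} (h : lam ∈ nearRectangular 4)
    (h0 : lam ∈ partitionsZero 4) : ∃ a b, lam = nearRect a b := by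
  have h1 : lam 1 ≤ lam 0 := h.1 (by decide)
  have h2 := h.2 1 2 (by decide) (by decide) (by decide) (by decide)
  have h3 := h0.2 3 rfl
  refine ⟨lam 0 - lam 1, lam 1, ?_⟩
  ext i
  fin_cases i <;> simp [nearRect] <;> lia

theorem exists_eq_ofColumns {nu : Fin 4 → ℕ} (h : Antitone nu) : ∃ n, nu = ofColumns n := by
  have h1 : nu 1 ≤ nu 0 := h (by decide)
  have h2 : nu 2 ≤ nu 1 := h (by decide)
  have h3 : nu 3 ≤ nu 2 := h (by decide)
  refine ⟨![nu 0 - nu 1, nu 1 - nu 2, nu 2 - nu 3, nu 3], ?_⟩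
  ext i
  fin_cases i <;> simp [ofColumns] <;> lia

theorem nearRect_mem_nearRectangular (a b : ℕ) : nearRect a b ∈ nearRectangular 4 := by
  refine ⟨antitone_nearRect a b, fun i j hi hi' hj hj' => ?_⟩
  fin_cases i <;> fin_cases j <;> simp [nearRect] at *

theorem nearRect_mem_partitionsZero (a b : ℕ) : nearRect a b ∈ partitionsZero 4 := by
  refine ⟨antitone_nearRect a b, fun i hi => ?_⟩
  fin_cases i <;> simp [nearRect] at *

/-- All the representation theory needed for the semigroup enters the convex geometry through this
equivalence. -/
theorem mem_semigroup_iff {t : Triple 4} :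
    t ∈ HornNR2 4 ∩ HornBar 4 ↔ ∃ m, t = weightTriple m := by
  constructor
  · rintro ⟨⟨⟨-, -, hnu, hlr⟩, h1, h2⟩, -, h3, h4⟩
    obtain ⟨lam, mu, nu⟩ := t
    obtain ⟨a, b, rfl : lam = _⟩ := exists_eq_nearRect h1 h3
    obtain ⟨c, d, rfl : mu = _⟩ := exists_eq_nearRect h2 h4
    obtain ⟨n, rfl : nu = _⟩ := exists_eq_ofColumns hnu
    rw [lrCoeff_eq_finrank] at hlr
    obtain ⟨⟨f, hf⟩, hf0⟩ := (Module.finrank_pos_iff_exists_ne_zero (R := ℂ)).1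
      (Nat.pos_of_ne_zero hlr)
    obtain ⟨hf1, hf2⟩ := mem_highestWeightSpace_nearRect.1 hf
    obtain ⟨m, rfl, rfl, rfl, rfl, rfl⟩ :=
      hf2.exists_exponents hf1 fun h => hf0 (Subtype.ext h)
    exact ⟨m, rfl⟩
  · rintro ⟨m, rfl⟩
    have h : weightTriple m ∈ Horn 4 := ⟨antitone_nearRect _ _, antitone_nearRect _ _,
      antitone_ofColumns _, lrCoeff_weightTriple_ne_zero m⟩
    exact ⟨⟨h, nearRect_mem_nearRectangular _ _, nearRect_mem_nearRectangular _ _⟩, h,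
      nearRect_mem_partitionsZero _ _, nearRect_mem_partitionsZero _ _⟩

theorem lrCoeff_weightTriple_eq_one {m : Fin 8 → ℕ} {i j : Fin 8} (hi : slope i = 1)
    (hj : slope j = -1) (hmi : m i = 0) (hmj : m j = 0) :
    lrCoeff (weightTriple m).1 (weightTriple m).2.1 (weightTriple m).2.2 = 1 := by
  -- For the weight of a monomial, `order` at $i$ is $m_i$ minus `slope i` times $m_3$, so for
  -- opposite slopes the sum is $m_i+m_j=0$.
  have hij : order (m 0 + m 4 + m 5) (m 2 + m 6 + m 7) (m 3 + m 5 + m 7) (columnsOf m) i +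
      order (m 0 + m 4 + m 5) (m 2 + m 6 + m 7) (m 3 + m 5 + m 7) (columnsOf m) j ≤ 0 := by
    fin_cases i <;> simp [slope] at hi <;> fin_cases j <;> simp [slope] at hj <;>
      simp [order, columnsOf] at * <;> lia
  rw [lrCoeff_eq_finrank]
  refine finrank_eq_one (⟨_, covariantMonomial_mem_highestWeightSpace m⟩ : highestWeightSpace _ _ _)
    (fun h => covariantMonomial_ne_zero m (congrArg Subtype.val h)) fun ⟨g, hg⟩ => ?_
  obtain ⟨hg1, hg2⟩ := mem_highestWeightSpace_nearRect.1 hg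
  obtain ⟨r, hr⟩ := (isHighestWeight_covariantMonomial m).exists_eq_smul (covariantMonomial_mem m)
    hg1 hg2 (covariantMonomial_ne_zero m) hi hj hij
  exact ⟨r, Subtype.ext hr⟩

end Semigroup
end LRCone

namespace LRCone

/-! ### The cone and the Hilbert basis -/

section Cone

/-- The eight generators, indexed as the covariants. -/
def generator : Fin 8 → Triple 4 :=
  ![(![1, 0, 0, 0], ![0, 0, 0, 0], ![1, 0, 0, 0]),
    (![0, 0, 0, 0], ![1, 0, 0, 0], ![1, 0, 0, 0]),
    (![1, 1, 1, 0], ![0, 0, 0, 0], ![1, 1, 1, 0]),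
    (![0, 0, 0, 0], ![1, 1, 1, 0], ![1, 1, 1, 0]),
    (![1, 0, 0, 0], ![1, 0, 0, 0], ![1, 1, 0, 0]),
    (![1, 0, 0, 0], ![1, 1, 1, 0], ![1, 1, 1, 1]),
    (![1, 1, 1, 0], ![1, 0, 0, 0], ![1, 1, 1, 1]),
    (![1, 1, 1, 0], ![1, 1, 1, 0], ![2, 2, 1, 1])]

theorem range_generator : Set.range generator = generators := by
  ext t
  simp only [Set.mem_range, generators, Set.mem_insert_iff, Set.mem_singleton_iff]
  constructor
  · rintro ⟨i, rfl⟩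
    fin_cases i <;> simp [generator]
  · rintro (rfl | rfl | rfl | rfl | rfl | rfl | rfl | rfl)
    exacts [⟨0, rfl⟩, ⟨1, rfl⟩, ⟨2, rfl⟩, ⟨3, rfl⟩, ⟨4, rfl⟩, ⟨5, rfl⟩, ⟨6, rfl⟩, ⟨7, rfl⟩]

theorem weightTriple_eq_sum (m : Fin 8 → ℕ) : weightTriple m = ∑ i, m i • generator i := by
  rw [Fin.sum_univ_eight]
  refine Prod.ext (funext fun k => ?_) (Prod.ext (funext fun k => ?_) (funext fun k => ?_)) <;>
    fin_cases k <;> simp [weightTriple, generator, nearRect, ofColumns, columnsOf] <;> ring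

theorem weightTriple_add (m m' : Fin 8 → ℕ) :
    weightTriple (m + m') = weightTriple m + weightTriple m' := by
  simp only [weightTriple_eq_sum, Pi.add_apply, add_smul, Finset.sum_add_distrib]

theorem weightTriple_single (i : Fin 8) (k : ℕ) :
    weightTriple (Pi.single i k) = k • generator i := by
  simp [weightTriple_eq_sum, Pi.single_apply, ite_smul]

theorem toRat_injective {n : ℕ} : Function.Injective (toRat (n := n)) := by
  rintro ⟨x, y, z⟩ ⟨x', y', z'⟩ h
  simpa [toRat, funext_iff] using h

theorem toRat_weightTriple (m : Fin 8 → ℕ) :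
    toRat (weightTriple m) = ∑ i, (m i : ℚ) • toRat (generator i) := by
  rw [Fin.sum_univ_eight]
  refine Prod.ext (funext fun k => ?_) (Prod.ext (funext fun k => ?_) (funext fun k => ?_)) <;>
    fin_cases k <;> simp [weightTriple, generator, nearRect, ofColumns, columnsOf, toRat] <;> ring

/-- The linear relations between the generators are the multiples of the one given by `slope`. -/
theorem eq_slope_mul_of_sum_eq_zero {q : Fin 8 → ℚ} (h : ∑ i, q i • toRat (generator i) = 0)
    (j : Fin 8) : q j = slope j * q 0 := by
  rw [Fin.sum_univ_eight] at h
  have h1 := congrFun (congrArg Prod.fst h)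
  have h2 := congrFun (congrArg (fun x => x.2.1) h)
  have h3 := congrFun (congrArg (fun x => x.2.2) h)
  have a0 := h1 0
  have a1 := h1 1
  have b0 := h2 0
  have b1 := h2 1
  have c0 := h3 0
  have c1 := h3 1
  have c2 := h3 2
  have c3 := h3 3
  simp [generator, toRat] at a0 a1 b0 b1 c0 c1 c2 c3
  fin_cases j <;> simp [slope] <;> linarith

theorem exists_slope_ne (i : Fin 8) : ∃ j l, slope j = 1 ∧ slope l = -1 ∧ i ≠ j ∧ i ≠ l := by
  decide +revert

theorem toRat_generator_ne_zero (i : Fin 8) : toRat (generator i) ≠ 0 := by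
  intro h
  have h3 := congrFun (congrArg (fun x => x.2.2) h) 0
  fin_cases i <;> simp [generator, toRat] at h3

/-- A nonnegative combination of the generators which is proportional to one of them involves
only this one. -/
theorem eq_single_of_sum_eq_smul {q : Fin 8 → ℚ} (hq : ∀ j, 0 ≤ q j) {i : Fin 8} {r : ℚ}
    (h : ∑ j, q j • toRat (generator j) = r • toRat (generator i)) : q = Pi.single i r := by
  have h0 : ∑ j, (q - Pi.single i r : Fin 8 → ℚ) j • toRat (generator j) = 0 := by
    simp [sub_smul, Finset.sum_sub_distrib, h, Pi.single_apply, ite_smul]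
  have key := eq_slope_mul_of_sum_eq_zero h0
  obtain ⟨j, l, hj, hl, hij, hil⟩ := exists_slope_ne i
  have h1 := key j
  have h2 := key l
  rw [hj, Pi.sub_apply, Pi.single_eq_of_ne hij.symm] at h1
  rw [hl, Pi.sub_apply, Pi.single_eq_of_ne hil.symm] at h2
  have h3 := hq j
  have h4 := hq l
  push_cast at h1 h2
  -- The multiple of the relation is at once the coefficient $q_j\ge0$ and minus the coefficient
  -- $q_l\ge0$, hence zero.
  have ht : (q - Pi.single i r : Fin 8 → ℚ) 0 = 0 := by linarith
  rw [← sub_eq_zero]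
  ext k
  rw [key k, ht, mul_zero, Pi.zero_apply]

theorem mem_ray {n : ℕ} {t : Triple n} {x : RatTriple n} :
    x ∈ ray t ↔ ∃ r : ℚ, 0 ≤ r ∧ r • toRat t = x :=
  Submodule.mem_span_singleton.trans ⟨fun ⟨r, h⟩ => ⟨r, r.2, h⟩, fun ⟨r, hr, h⟩ => ⟨⟨r, hr⟩, h⟩⟩

theorem coneOf_semigroup : coneOf (HornNR2 4 ∩ HornBar 4) =
    PointedCone.hull ℚ (Set.range fun i => toRat (generator i)) := by
  apply le_antisymm
  · refine Submodule.span_le.2 ?_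
    rintro _ ⟨t, ht, rfl⟩
    obtain ⟨m, rfl⟩ := mem_semigroup_iff.1 ht
    rw [toRat_weightTriple]
    refine sum_mem fun i _ => ?_
    exact Submodule.smul_mem _ (⟨m i, by positivity⟩ : {r : ℚ // 0 ≤ r})
      (Submodule.subset_span ⟨i, rfl⟩)
  · refine Submodule.span_mono ?_
    rintro _ ⟨i, rfl⟩
    exact ⟨generator i, mem_semigroup_iff.2 ⟨Pi.single i 1, by simp [weightTriple_single]⟩, rfl⟩

theorem mem_coneOf_semigroup {x : RatTriple 4} : x ∈ coneOf (HornNR2 4 ∩ HornBar 4) ↔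
    ∃ q : Fin 8 → ℚ, (∀ i, 0 ≤ q i) ∧ ∑ i, q i • toRat (generator i) = x := by
  rw [coneOf_semigroup]
  exact (Submodule.mem_span_range_iff_exists_fun _).trans
    ⟨fun ⟨q, h⟩ => ⟨fun i => q i, fun i => (q i).2, h⟩,
      fun ⟨q, hq, h⟩ => ⟨fun i => ⟨q i, hq i⟩, h⟩⟩

theorem toRat_generator_mem (i : Fin 8) :
    toRat (generator i) ∈ coneOf (HornNR2 4 ∩ HornBar 4) :=
  mem_coneOf_semigroup.2 ⟨Pi.single i 1, fun j => by
    rw [Pi.single_apply]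
    split_ifs <;> simp, by simp [Pi.single_apply, ite_smul]⟩

theorem isExtremalRay_ray_generator (i : Fin 8) :
    IsExtremalRay (coneOf (HornNR2 4 ∩ HornBar 4)) (ray (generator i)) := by
  refine ⟨⟨?_, ?_⟩, _, toRat_generator_ne_zero i, rfl⟩
  · exact Submodule.span_le.2 (Set.singleton_subset_iff.2 (toRat_generator_mem i))
  · intro x y a hx hy ha h
    obtain ⟨p, hp, rfl⟩ := mem_coneOf_semigroup.1 hx
    obtain ⟨q, hq, rfl⟩ := mem_coneOf_semigroup.1 hy
    obtain ⟨r, -, hr⟩ := mem_ray.1 h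
    have key := eq_single_of_sum_eq_smul (q := a • p + q) (i := i) (r := r)
      (fun j => add_nonneg (mul_nonneg ha.le (hp j)) (hq j))
      (by simp [hr, add_smul, mul_smul, Finset.sum_add_distrib, Finset.smul_sum])
    refine mem_ray.2 ⟨p i, hp i, (Finset.sum_eq_single (f := fun j => p j • toRat (generator j)) i
      (fun j _ hj => ?_) fun h => absurd (Finset.mem_univ i) h).symm⟩
    have h1 : a * p j + q j = 0 := by simpa [Pi.single_eq_of_ne hj] using congrFun key j
    have h2 : p j = 0 := by
      have := mul_nonneg ha.le (hp j)
      have := hq j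
      exact (mul_eq_zero.1 (show a * p j = 0 by linarith)).resolve_left ha.ne'
    simp only [h2, zero_smul]

theorem exists_eq_ray_of_isExtremalRay {R : PointedCone ℚ (RatTriple 4)}
    (hR : IsExtremalRay (coneOf (HornNR2 4 ∩ HornBar 4)) R) : ∃ i, R = ray (generator i) := by
  obtain ⟨hface, v, hv, rfl⟩ := hR
  have hvR : v ∈ PointedCone.hull ℚ {v} := Submodule.mem_span_singleton_self v
  obtain ⟨q, hq, hqv⟩ := mem_coneOf_semigroup.1 (hface.le hvR)
  obtain ⟨i, hi⟩ : ∃ i, q i ≠ 0 := by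
    by_contra! h
    exact hv (by simp [← hqv, h])
  have hrest : ∑ j ∈ Finset.univ.erase i, q j • toRat (generator j) ∈
      coneOf (HornNR2 4 ∩ HornBar 4) :=
    sum_mem fun j _ => Submodule.smul_mem _ (⟨q j, hq j⟩ : {r : ℚ // 0 ≤ r}) (toRat_generator_mem j)
  -- A generator occurring in $v$ with positive coefficient is a summand of a point of the face, so
  -- it lies on the face and spans it.
  have hmem : toRat (generator i) ∈ PointedCone.hull ℚ {v} :=
    hface.mem_of_smul_add_mem (toRat_generator_mem i) hrest ((hq i).lt_of_ne' hi)
      (by rwa [Finset.add_sum_erase _ (fun j => q j • toRat (generator j)) (Finset.mem_univ i), hqv])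
  refine ⟨i, le_antisymm ?_ (Submodule.span_le.2 (Set.singleton_subset_iff.2 hmem))⟩
  obtain ⟨r, hr⟩ := Submodule.mem_span_singleton.1 hmem
  have hr' : (r : ℚ) • v = toRat (generator i) := hr
  have hr0 : (r : ℚ) ≠ 0 := by
    intro h
    rw [h, zero_smul] at hr'
    exact toRat_generator_ne_zero i hr'.symm
  refine Submodule.span_le.2 (Set.singleton_subset_iff.2 (mem_ray.2 ⟨(r : ℚ)⁻¹, ?_, ?_⟩))
  · exact inv_nonneg.2 r.2
  · rw [← hr', inv_smul_smul₀ hr0]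

theorem setOf_isExtremalRay : {R | IsExtremalRay (coneOf (HornNR2 4 ∩ HornBar 4)) R} =
    Set.range fun i => ray (generator i) := by
  ext R
  constructor
  · intro hR
    obtain ⟨i, rfl⟩ := exists_eq_ray_of_isExtremalRay hR
    exact ⟨i, rfl⟩
  · rintro ⟨i, rfl⟩
    exact isExtremalRay_ray_generator i

theorem ray_generator_injective : Function.Injective fun i => ray (generator i) := by
  intro i j (h : ray (generator i) = ray (generator j))
  have h1 : toRat (generator i) ∈ ray (generator j) :=
    h ▸ mem_ray.2 ⟨1, zero_le_one, one_smul _ _⟩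
  obtain ⟨r, -, hr⟩ := mem_ray.1 h1
  have key := eq_single_of_sum_eq_smul (q := Pi.single i 1) (i := j) (r := r)
    (fun k => by
      rw [Pi.single_apply]
      split_ifs <;> simp) (by simp [hr, Pi.single_apply, ite_smul])
  by_contra hij
  have := congrFun key i
  simp [hij] at this

theorem exists_eq_nsmul_of_mem_ray {t : Triple 4} {i : Fin 8}
    (h : toRat t ∈ ray (generator i)) : ∃ k : ℕ, t = k • generator i := by
  obtain ⟨r, -, hr⟩ := mem_ray.1 h
  -- Each generator has leading entry $1$ in its first or its second partition, so the scalar is an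
  -- entry of the integral triple.
  obtain ⟨k, rfl⟩ : ∃ k : ℕ, r = k := by
    have h1 := congrFun (congrArg Prod.fst hr) 0
    have h2 := congrFun (congrArg (fun x => x.2.1) hr) 0
    fin_cases i <;> simp [generator, toRat] at h1 h2
    exacts [⟨_, h1⟩, ⟨_, h2⟩, ⟨_, h1⟩, ⟨_, h2⟩, ⟨_, h1⟩, ⟨_, h1⟩, ⟨_, h1⟩, ⟨_, h1⟩]
  refine ⟨k, toRat_injective ?_⟩
  rw [← hr, ← weightTriple_single, toRat_weightTriple]
  simp [Pi.single_apply, ite_smul]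

theorem lrCoeff_nsmul_generator (k : ℕ) (i : Fin 8) : lrCoeff (k • generator i).1
    (k • generator i).2.1 (k • generator i).2.2 = 1 := by
  obtain ⟨j, l, hj, hl, hij, hil⟩ := exists_slope_ne i
  rw [← weightTriple_single]
  exact lrCoeff_weightTriple_eq_one hj hl (Pi.single_eq_of_ne hij.symm _)
    (Pi.single_eq_of_ne hil.symm _)

theorem closure_generators :
    (AddSubmonoid.closure generators : Set (Triple 4)) = HornNR2 4 ∩ HornBar 4 := by
  rw [← range_generator]
  ext t
  rw [mem_semigroup_iff, SetLike.mem_coe]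
  constructor
  · intro ht
    induction ht using AddSubmonoid.closure_induction with
    | mem t ht =>
      obtain ⟨i, rfl⟩ := ht
      exact ⟨Pi.single i 1, by simp [weightTriple_single]⟩
    | zero => exact ⟨0, by simp [weightTriple_eq_sum]⟩
    | add s t _ _ hs ht =>
      obtain ⟨m, rfl⟩ := hs
      obtain ⟨m', rfl⟩ := ht
      exact ⟨m + m', (weightTriple_add m m').symm⟩
  · rintro ⟨m, rfl⟩
    rw [weightTriple_eq_sum]
    exact sum_mem fun i _ => nsmul_mem (AddSubmonoid.subset_closure (Set.mem_range_self i)) _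

/-- Generators are indecomposable: in a sum $y+z$ of elements of $S$ equal to $g_i$, with $y\ne0$,
all exponents off $i$ vanish and those at $i$ add up to $1$, so $y=g_i$. -/
theorem generator_mem_of_closure_eq {H : Set (Triple 4)}
    (hH : (AddSubmonoid.closure H : Set (Triple 4)) = HornNR2 4 ∩ HornBar 4) (i : Fin 8) :
    generator i ∈ H := by
  have hS : ∀ x, x ∈ AddSubmonoid.closure H ↔ ∃ m, x = weightTriple m := fun x => by
    rw [← mem_semigroup_iff, ← hH, SetLike.mem_coe]
  -- A nonzero element of the closure has a nonzero first summand in `H` itself; indecomposability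
  -- applies to this one.
  have split : ∀ x ∈ AddSubmonoid.closure H, x ≠ 0 →
      ∃ y ∈ H, y ≠ 0 ∧ ∃ z ∈ AddSubmonoid.closure H, x = y + z := by
    intro x hx
    induction hx using AddSubmonoid.closure_induction_left with
    | zero => exact fun h => absurd rfl h
    | add_left x hx y hy ih =>
      intro hxy
      by_cases hx0 : x = 0
      · rw [hx0, zero_add] at hxy ⊢
        exact ih hxy
      · exact ⟨x, hx, hx0, y, hy, rfl⟩
  have hi : generator i = weightTriple (Pi.single i 1) := by simp [weightTriple_single]
  have hi0 : generator i ≠ 0 := fun h => toRat_generator_ne_zero i (by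
    rw [h]
    simp [toRat]
    rfl)
  obtain ⟨y, hy, hy0, z, hz, hyz⟩ := split _ ((hS _).2 ⟨_, hi⟩) hi0
  obtain ⟨p, rfl⟩ := (hS y).1 (AddSubmonoid.subset_closure hy)
  obtain ⟨q, rfl⟩ := (hS z).1 hz
  rw [← weightTriple_add] at hyz
  have key := eq_single_of_sum_eq_smul (q := fun j => ((p + q) j : ℚ)) (i := i) (r := 1)
    (fun j => by positivity) (by rw [← toRat_weightTriple, ← hyz, one_smul])
  have hp : ∀ j, j ≠ i → p j = 0 := fun j hj => by
    have h1 : ((p j + q j : ℕ) : ℚ) = 0 := by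
      simpa [Pi.single_eq_of_ne hj] using congrFun key j
    have h2 : p j + q j = 0 := by exact_mod_cast h1
    lia
  have hpi : p i + q i = 1 := by
    have h1 : ((p i + q i : ℕ) : ℚ) = 1 := by simpa using congrFun key i
    exact_mod_cast h1
  have hps : p = Pi.single i (p i) := by
    ext j
    by_cases hj : j = i
    · rw [hj, Pi.single_eq_same]
    · rw [hp j hj, Pi.single_eq_of_ne hj]
  rw [hps, weightTriple_single] at hy hy0
  have hpi0 : p i ≠ 0 := fun h => hy0 (by rw [h, zero_smul])
  rwa [show p i = 1 by lia, one_smul] at hy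

theorem isHilbertBasis_generators : IsHilbertBasis (HornNR2 4 ∩ HornBar 4) generators := by
  refine ⟨closure_generators, fun H hH => ?_⟩
  rw [← range_generator]
  rintro _ ⟨i, rfl⟩
  exact generator_mem_of_closure_eq hH i

end Cone
end LRCone

theorem mainTheorem9 :
    -- the extremal rays of the cone are exactly the rays spanned by the eight generators
    {R | LRCone.IsExtremalRay (LRCone.coneOf (LRCone.HornNR2 4 ∩ LRCone.HornBar 4)) R} =
        LRCone.ray '' LRCone.generators ∧
    -- and there are exactly eight of them
    {R | LRCone.IsExtremalRay
        (LRCone.coneOf (LRCone.HornNR2 4 ∩ LRCone.HornBar 4)) R}.ncard = 8 ∧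
    -- every integral triple on an extremal ray has Littlewood-Richardson coefficient one
    (∀ R, LRCone.IsExtremalRay (LRCone.coneOf (LRCone.HornNR2 4 ∩ LRCone.HornBar 4)) R →
      ∀ lam mu nu : Fin 4 → ℕ, LRCone.toRat (lam, mu, nu) ∈ R →
        LRCone.lrCoeff lam mu nu = 1) ∧
    -- the eight generators form the Hilbert basis of the semigroup
    LRCone.IsHilbertBasis (LRCone.HornNR2 4 ∩ LRCone.HornBar 4) LRCone.generators := by
  refine ⟨?_, ?_, ?_, LRCone.isHilbertBasis_generators⟩
  · rw [LRCone.setOf_isExtremalRay, ← LRCone.range_generator, ← Set.range_comp]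
    rfl
  · rw [LRCone.setOf_isExtremalRay, ← Set.image_univ,
      Set.ncard_image_of_injective _ LRCone.ray_generator_injective, Set.ncard_univ, Nat.card_fin]
  · intro R hR lam mu nu h
    obtain ⟨i, rfl⟩ := LRCone.exists_eq_ray_of_isExtremalRay hR
    obtain ⟨k, hk⟩ := LRCone.exists_eq_nsmul_of_mem_ray h
    have := LRCone.lrCoeff_nsmul_generator k i
    rwa [← hk] at this
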